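/- Let $M=\mathbb H^3/\Gamma$ be a complete orientable hyperbolic 3-manifold of finite volume with at least one cusp, where $\Gamma\subset \mathrm{PSL}_2(\mathbb C)$ is discrete and torsion-free. The invariant trace field $k(M)\subset\mathbb C$ is the field generated over $\mathbb Q$ by the traces (defined up to sign) of the elements of the subgroup $\Gamma^{2}=\langle \gamma^2 : \gamma\in\Gamma\rangle$. For each cusp choose an essential simple closed oriented curve (the meridian) in the cusp torus, and the horospherical cross-section on which the geodesic meridian has length $1$. The cross-sections lift to horospheres in $\mathbb H^3$; let $P_i$ denote the center of the lifted horosphere $H_i$. Each $H_i$ is regarded as a complex plane, with coordinate (up to translation) in which the meridional translation is translation by $1$: if an orientation-preserving isometry moves $P_i$ to $\infty$ and the meridional translation to $z\mapsto z+1$, the coordinate is $z$. For $H_i\neq H_j$, let $d$ be the length of the shortest geodesic arc from $H_i$ to $H_j$, and let $\theta$ be the angle (mod $2\pi$) by which, after parallel translation along this arc, the meridional direction of $H_i$ has to be rotated in $H_j$ (with the orientation given by the complex coordinate of $H_j$) to give the meridional direction of $H_j$. The intercusp parameter is $w(H_i,H_j)=e^{-(d+i\theta)}$. For $H_i\ne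 H_j\ne H_k$ (with $H_i=H_k$ allowed), the translation parameter $u(H_i,H_j,H_k)$ is the complex number representing, in the coordinate of $H_j$, the translation that takes the point where $H_j$ meets the geodesic $P_iP_j$ to the point where $H_j$ meets the geodesic $P_jP_k$. Then all these parameters are well defined, and every intercusp parameter $w(H_i,H_j)$ and every translation parameter $u(H_i,H_j,H_k)$ lies in $k(M)$. -/

import Mathlib

open Matrix MeasureTheory
open scoped MatrixGroups

noncomputable section

namespace HypThree

/-! ### Hyperbolic 3-space: the upper half-space model -/

/-- Hyperbolic 3-space, as the upper half-space `ℂ × ℝ_{>0}`. -/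
def UpperHalfSpace : Type := {p : ℂ × ℝ // 0 < p.2}

namespace UpperHalfSpace

/-- The coordinates `(z, t) ∈ ℂ × ℝ` of a point. -/
def coords (p : UpperHalfSpace) : ℂ × ℝ := p.1

/-- The horizontal coordinate. -/
def z (p : UpperHalfSpace) : ℂ := p.1.1

/-- The height. -/
def t (p : UpperHalfSpace) : ℝ := p.1.2

lemma t_pos (p : UpperHalfSpace) : 0 < p.t := p.2

@[ext] lemma ext {p q : UpperHalfSpace} (hz : p.z = q.z) (ht : p.t = q.t) : p = q :=
  Subtype.ext (Prod.ext hz ht)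

/-- The point `(z, t)`, for `t > 0`. -/
def mk (z : ℂ) (t : ℝ) (ht : 0 < t) : UpperHalfSpace := ⟨(z, t), ht⟩

@[simp] lemma z_mk (z : ℂ) (t : ℝ) (ht : 0 < t) : (mk z t ht).z = z := rfl

@[simp] lemma t_mk (z : ℂ) (t : ℝ) (ht : 0 < t) : (mk z t ht).t = t := rfl

instance : MeasurableSpace UpperHalfSpace := .comap coords inferInstance

/-- The hyperbolic volume `dx dy dt / t ^ 3`. -/
instance : MeasureSpace UpperHalfSpace :=
  ⟨((volume : Measure (ℂ × ℝ)).comap coords).withDensity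
    fun p ↦ ENNReal.ofReal (1 / p.t ^ 3)⟩

/-- The hyperbolic distance, `cosh d = 1 + (|z - z'|² + (t - t')²) / (2 t t')`. -/
def hdist (p q : UpperHalfSpace) : ℝ :=
  Real.arcosh (1 + (‖p.z - q.z‖ ^ 2 + (p.t - q.t) ^ 2) / (2 * p.t * q.t))

/-- The hyperbolic norm of a vector `v` tangent at the point `p`. -/
def tangentNorm (p : UpperHalfSpace) (v : ℂ × ℝ) : ℝ :=
  √(‖v.1‖ ^ 2 + v.2 ^ 2) / p.t

/-- The hyperbolic length of the curve `c` restricted to `[0, 1]`. -/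
def pathLength (c : ℝ → UpperHalfSpace) : ℝ :=
  ∫ s in (0 : ℝ)..1, tangentNorm (c s) (deriv (fun r ↦ (c r).coords) s)

/-- The denominator `|cz + d|² + |c|² t²` in the action of a matrix. -/
def denom (A : SL(2, ℂ)) (p : UpperHalfSpace) : ℝ :=
  Complex.normSq (A 1 0 * p.z + A 1 1) + Complex.normSq (A 1 0) * p.t ^ 2

lemma det_eq (A : SL(2, ℂ)) : A 0 0 * A 1 1 - A 0 1 * A 1 0 = 1 := by
  have := A.det_coe
  rwa [Matrix.det_fin_two] at this

lemma denom_pos (A : SL(2, ℂ)) (p : UpperHalfSpace) : 0 < denom A p := by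
  have ht := p.t_pos
  unfold denom
  by_cases hc : A 1 0 = 0
  · have hd : A 1 1 ≠ 0 := by
      intro hd
      have := det_eq A
      simp [hc, hd] at this
    have := Complex.normSq_pos.2 hd
    simpa [hc] using this
  · have h1 := Complex.normSq_pos.2 hc
    have h2 := Complex.normSq_nonneg (A 1 0 * p.z + A 1 1)
    positivity

/-- The numerator of the horizontal coordinate in the action of a matrix. -/
def numer (A : SL(2, ℂ)) (p : UpperHalfSpace) : ℂ :=
  (A 0 0 * p.z + A 0 1) * star (A 1 0 * p.z + A 1 1) + A 0 0 * star (A 1 0) * (p.t : ℂ) ^ 2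

/-- The action of `SL(2, ℂ)` on the upper half-space by orientation-preserving isometries: the
Poincaré extension of the Möbius action on `ℂ ∪ {∞}`. -/
instance : SMul SL(2, ℂ) UpperHalfSpace where
  smul A p := mk (numer A p / denom A p) (p.t / denom A p) (div_pos p.t_pos (denom_pos A p))

lemma smul_z (A : SL(2, ℂ)) (p : UpperHalfSpace) : (A • p).z = numer A p / denom A p := rfl

lemma smul_t (A : SL(2, ℂ)) (p : UpperHalfSpace) : (A • p).t = p.t / denom A p := rfl

lemma denom_coe (A : SL(2, ℂ)) (p : UpperHalfSpace) : (denom A p : ℂ) =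
    (A 1 0 * p.z + A 1 1) * star (A 1 0 * p.z + A 1 1) +
      A 1 0 * star (A 1 0) * (p.t : ℂ) ^ 2 := by
  simp [denom, ← Complex.mul_conj]

lemma star_det_eq (A : SL(2, ℂ)) :
    star (A 0 0) * star (A 1 1) - star (A 0 1) * star (A 1 0) = 1 := by
  have := congrArg star (det_eq A)
  simpa using this

lemma numer_mul_star (A : SL(2, ℂ)) (p : UpperHalfSpace) :
    numer A p * star (numer A p) + (p.t : ℂ) ^ 2 = denom A p *
      ((A 0 0 * p.z + A 0 1) * star (A 0 0 * p.z + A 0 1) +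
        A 0 0 * star (A 0 0) * (p.t : ℂ) ^ 2) := by
  have h1 := det_eq A
  have h2 := star_det_eq A
  have ht : star (p.t : ℂ) = p.t := Complex.conj_ofReal _
  rw [denom_coe]
  simp only [numer, star_add, star_mul', star_pow, star_star, ht]
  linear_combination (-(p.t : ℂ) ^ 2 * (A 0 0 * A 1 1 - A 0 1 * A 1 0)) * h2 -
    (p.t : ℂ) ^ 2 * h1

lemma mul_entry (A B : SL(2, ℂ)) (i j : Fin 2) :
    (A * B) i j = A i 0 * B 0 j + A i 1 * B 1 j := by
  simp [Matrix.mul_apply, Fin.sum_univ_two]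

lemma denom_mul (A B : SL(2, ℂ)) (p : UpperHalfSpace) :
    denom (A * B) p = denom A (B • p) * denom B p := by
  have hB : (denom B p : ℂ) ≠ 0 := by exact_mod_cast (denom_pos B p).ne'
  have hs : star (denom B p : ℂ) = denom B p := Complex.conj_ofReal _
  have key := numer_mul_star B p
  apply Complex.ofReal_injective
  rw [Complex.ofReal_mul, denom_coe A, denom_coe (A * B), smul_z, smul_t]
  simp only [mul_entry, star_add, star_mul', star_div₀, hs, Complex.ofReal_div]
  field_simp
  have hd := denom_coe B p
  simp only [star_add, star_mul'] at hd key
  simp only [numer, star_add, star_mul', star_pow, star_star,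
    show star (p.t : ℂ) = p.t from Complex.conj_ofReal _] at key ⊢
  linear_combination (-(A 1 0 * star (A 1 0))) * key - (denom B p : ℂ) *
    (A 1 1 * star (A 1 1)) * hd

lemma numer_mul (A B : SL(2, ℂ)) (p : UpperHalfSpace) :
    numer (A * B) p = numer A (B • p) * denom B p := by
  have hB : (denom B p : ℂ) ≠ 0 := by exact_mod_cast (denom_pos B p).ne'
  have hs : star (denom B p : ℂ) = denom B p := Complex.conj_ofReal _
  have key := numer_mul_star B p
  unfold numer
  rw [smul_z, smul_t]
  simp only [mul_entry, star_add, star_mul', star_div₀, hs, Complex.ofReal_div]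
  field_simp
  have hd := denom_coe B p
  simp only [star_add, star_mul'] at hd key
  simp only [numer, star_add, star_mul', star_pow, star_star,
    show star (p.t : ℂ) = p.t from Complex.conj_ofReal _] at key ⊢
  linear_combination (-(A 0 0 * star (A 1 0))) * key - (denom B p : ℂ) *
    (A 0 1 * star (A 1 1)) * hd

instance : MulAction SL(2, ℂ) UpperHalfSpace where
  one_smul p := by
    ext
    · simp [smul_z, numer, denom]
    · simp [smul_t, denom]
  mul_smul A B p := by
    have hB : (denom B p : ℂ) ≠ 0 := by exact_mod_cast (denom_pos B p).ne'
    have hB' := (denom_pos B p).ne'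
    have hA' := (denom_pos A (B • p)).ne'
    ext
    · rw [smul_z, smul_z A, numer_mul, denom_mul, Complex.ofReal_mul, mul_div_mul_right _ _ hB]
    · rw [smul_t, smul_t A, smul_t B, denom_mul]
      field_simp

lemma center_smul (A : SL(2, ℂ)) (hA : A ∈ Subgroup.center SL(2, ℂ)) (p : UpperHalfSpace) :
    A • p = p := by
  have h := Matrix.SpecialLinearGroup.scalar_eq_self_of_mem_center hA 0
  have h01 : A 0 1 = 0 := by simpa using (congrFun (congrFun h 0) 1).symm
  have h10 : A 1 0 = 0 := by simpa using (congrFun (congrFun h 1) 0).symm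
  have h11 : A 1 1 = A 0 0 := by simpa using (congrFun (congrFun h 1) 1).symm
  have hdet : A 0 0 * A 0 0 = 1 := by simpa [h01, h11] using det_eq A
  have hn : denom A p = 1 := by
    have := congrArg Complex.normSq hdet
    simp only [map_mul, map_one] at this
    simp only [denom, h10, h11, zero_mul, zero_add, map_zero, add_zero]
    nlinarith [Complex.normSq_nonneg (A 0 0)]
  have hm : A 0 0 * star (A 0 0) = 1 := by
    have := denom_coe A p
    simpa [hn, h10, h11] using this.symm
  ext
  · rw [smul_z, hn, Complex.ofReal_one, div_one]
    simp only [numer, h01, h10, h11, star_add, star_mul', star_zero]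
    linear_combination p.z * hm
  · rw [smul_t, hn, div_one]

/-- The action of `PSL(2, ℂ)`, the group of orientation-preserving isometries of hyperbolic
3-space. -/
instance : MulAction PSL(2, ℂ) UpperHalfSpace :=
  MulAction.compHom UpperHalfSpace
    (QuotientGroup.lift (Subgroup.center SL(2, ℂ)) (MulAction.toPermHom SL(2, ℂ) UpperHalfSpace)
      fun A hA ↦ Equiv.ext fun p ↦ center_smul A hA p)

lemma coe_smul (A : SL(2, ℂ)) (p : UpperHalfSpace) : (A : PSL(2, ℂ)) • p = A • p := rfl

end UpperHalfSpace

open UpperHalfSpace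

/-- The point of the sphere at infinity `ℂ ∪ {∞}` to which a matrix sends `P`, for the action by
Möbius transformations. -/
def moebius (A : SL(2, ℂ)) (P : OnePoint ℂ) : OnePoint ℂ := (A : GL (Fin 2) ℂ) • P

/-- The geodesic line from the ideal point `P` to the ideal point `Q`: the image of the vertical
axis under an isometry taking `0` to `P` and `∞` to `Q`. -/
def geodesicLine (P Q : OnePoint ℂ) : Set UpperHalfSpace :=
  {p | ∃ g : SL(2, ℂ), moebius g ((0 : ℂ) : OnePoint ℂ) = P ∧ moebius g OnePoint.infty = Q ∧
    ∃ (t : ℝ) (ht : 0 < t), p = g • UpperHalfSpace.mk 0 t ht}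

/-- `H` is a horosphere centered at the ideal point `P`: a horizontal plane if `P = ∞`, and
a Euclidean sphere tangent to `ℂ` at `P` (without `P` itself) otherwise. -/
def IsHorosphere (H : Set UpperHalfSpace) (P : OnePoint ℂ) : Prop :=
  ∃ r : ℝ, 0 < r ∧
    ((P = OnePoint.infty ∧ H = {p | p.t = r}) ∨
      ∃ a : ℂ, P = (a : OnePoint ℂ) ∧ H = {p | ‖p.z - a‖ ^ 2 + p.t ^ 2 = r * p.t})

/-- `T` is the transvection taking `p` to `q`, that is, the pure translation (without rotation)
along the geodesic through `p` and `q`. Its differential is the parallel transport from `p` to `q`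
along the geodesic arc joining them. -/
def IsTransvection (T : SL(2, ℂ)) (p q : UpperHalfSpace) : Prop :=
  ∃ (g D : SL(2, ℂ)) (l : ℝ), 0 < l ∧ (D : Matrix (Fin 2) (Fin 2) ℂ) = !![(l : ℂ), 0; 0, (l : ℂ)⁻¹] ∧
    T = g * D * g⁻¹ ∧ p = g • UpperHalfSpace.mk 0 1 one_pos ∧ T • p = q

/-- The complex power `1 + u (A - 1)` of a parabolic matrix `A` of trace `2`. On each horosphere
centered at the fixed point of `A` these act as the group of translations, and `u` is the complex
coordinate of the translation for the affine complex structure in which `A` is the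
translation by `1`. In the position where `A` is `z ↦ z + 1` it is `z ↦ z + u`. -/
def horoTranslation (A : SL(2, ℂ)) (hA : (A : Matrix (Fin 2) (Fin 2) ℂ).trace = 2) (u : ℂ) :
    SL(2, ℂ) :=
  ⟨1 + u • ((A : Matrix (Fin 2) (Fin 2) ℂ) - 1), by
    have h := det_eq A
    rw [Matrix.trace_fin_two] at hA
    simp only [Matrix.det_fin_two, Matrix.add_apply, Matrix.smul_apply, Matrix.sub_apply,
      Matrix.one_apply_eq, smul_eq_mul, Matrix.one_apply_ne (show (0 : Fin 2) ≠ 1 by decide),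
      Matrix.one_apply_ne (show (1 : Fin 2) ≠ 0 by decide)]
    linear_combination (u - u ^ 2) * hA + u ^ 2 * h⟩

/-- The quotient of hyperbolic 3-space by `Γ` has finite volume: `Γ` has a fundamental domain
of finite volume. -/
def HasFiniteCovolume (Γ : Subgroup PSL(2, ℂ)) : Prop :=
  ∃ F : Set UpperHalfSpace, IsFundamentalDomain Γ F ∧ volume F < ⊤

/-- `Γ` is the group of a complete orientable hyperbolic 3-manifold `ℍ³ / Γ` of finite volume:
it is discrete, torsion-free and of finite covolume. -/
structure IsFiniteVolumeManifoldGroup (Γ : Subgroup PSL(2, ℂ)) : Prop where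
  discrete : DiscreteTopology Γ
  torsionFree : ∀ γ ∈ Γ, IsOfFinOrder γ → γ = 1
  finiteCovolume : HasFiniteCovolume Γ

/-- The invariant trace field: the field generated over `ℚ` by the traces (defined up to sign) of
the elements of the subgroup generated by the squares of the elements of `Γ`. -/
def invariantTraceField (Γ : Subgroup PSL(2, ℂ)) : IntermediateField ℚ ℂ :=
  IntermediateField.adjoin ℚ
    {x | ∃ A : SL(2, ℂ), (A : PSL(2, ℂ)) ∈ Subgroup.closure {δ | ∃ γ ∈ Γ, δ = γ ^ 2} ∧
      x = (A : Matrix (Fin 2) (Fin 2) ℂ).trace}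

/-- The ideal points of hyperbolic 3-space lying over the cusps of `ℍ³ / Γ`: the fixed points of
the parabolic elements of `Γ`. -/
def CuspPoint (Γ : Subgroup PSL(2, ℂ)) : Type :=
  {P : OnePoint ℂ // ∃ A : SL(2, ℂ), (A : PSL(2, ℂ)) ∈ Γ ∧
    (A : Matrix (Fin 2) (Fin 2) ℂ).IsParabolic ∧ moebius A P = P}

/-- A choice, for each cusp of `ℍ³ / Γ`, of an oriented meridian and of the horospherical
cross-section on which this meridian has length one, described by the lifts to `ℍ³`.

An essential simple closed oriented curve in the cusp corresponds to a primitive element of the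
stabilizer of each of the ideal points over the cusp, in a way compatible with the action
of `Γ`; it is given by its representative of trace `2` in `SL(2, ℂ)`. The normalization
of the length determines the horospheres, so that they are permuted by `Γ`. -/
structure CuspSections (Γ : Subgroup PSL(2, ℂ)) where
  /-- the meridional translation at each ideal point over a cusp -/
  mer : CuspPoint Γ → SL(2, ℂ)
  mer_mem : ∀ P, (mer P : PSL(2, ℂ)) ∈ Γ
  mer_ne_one : ∀ P, mer P ≠ 1
  mer_trace : ∀ P, (mer P : Matrix (Fin 2) (Fin 2) ℂ).trace = 2
  mer_fix : ∀ P, moebius (mer P) P.1 = P.1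
  mer_primitive : ∀ P, ∀ γ ∈ Γ, ∀ n : ℤ, γ ^ n = (mer P : PSL(2, ℂ)) → n = 1 ∨ n = -1
  mer_conj : ∀ (A : SL(2, ℂ)), (A : PSL(2, ℂ)) ∈ Γ → ∀ P Q : CuspPoint Γ,
    moebius A P.1 = Q.1 → mer Q = A * mer P * A⁻¹
  /-- the horosphere centered at each ideal point over a cusp -/
  horo : CuspPoint Γ → Set UpperHalfSpace
  horo_isHorosphere : ∀ P, IsHorosphere (horo P) P.1
  /-- The flow line of the meridional translation, from a point `p` of the horosphere to its
  translate, projects to the geodesic meridian of the torus; it has length one. -/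
  mer_length : ∀ P, ∀ p ∈ horo P,
    pathLength (fun s ↦ horoTranslation (mer P) (mer_trace P) s • p) = 1

namespace CuspSections

variable {Γ : Subgroup PSL(2, ℂ)} (S : CuspSections Γ)

/-- The translation with complex coordinate `u` of the horosphere centered at `P`, where the
coordinate is the one in which the meridional translation is `1`. -/
def translation (P : CuspPoint Γ) (u : ℂ) : SL(2, ℂ) :=
  horoTranslation (S.mer P) (S.mer_trace P) u

/-- The complex distance from the horosphere `H₁` centered at `P` to the horosphere `H₂` centered
at `Q` is `d + iθ`. Here `p ∈ H₁` and `q ∈ H₂` are the endpoints of the shortest arc between them,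
and `d` is its length. The tangent vector `v` at `q` is the parallel transport along
this arc of the meridional direction of `H₁` at `p`, and rotating it by the angle `θ` in `H₂` gives
the meridional direction of `H₂` at `q`; so in the complex coordinate of `H₂`, where the meridional
direction is `1`, the direction of `v` is `e^{-iθ}`. -/
def IsComplexDistance (P Q : CuspPoint Γ) (d θ : ℝ) : Prop :=
  ∃ p ∈ S.horo P, ∃ q ∈ S.horo Q,
    (∀ p' ∈ S.horo P, ∀ q' ∈ S.horo Q, hdist p q ≤ hdist p' q') ∧
    d = hdist p q ∧
    ∃ (T : SL(2, ℂ)) (v : ℂ × ℝ), IsTransvection T p q ∧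
      HasDerivAt (fun s : ℝ ↦ (T • S.translation P s • p).coords) v 0 ∧
      HasDerivAt (fun s : ℝ ↦ (S.translation Q (s * Complex.exp (-(θ * Complex.I))) • q).coords)
        v 0

/-- `w` is the intercusp parameter `e^{-(d + iθ)}` of the horospheres centered at `P` and `Q`. -/
def IsIntercuspParameter (P Q : CuspPoint Γ) (w : ℂ) : Prop :=
  ∃ d θ : ℝ, S.IsComplexDistance P Q d θ ∧ w = Complex.exp (-(d + θ * Complex.I))

/-- `u` is the translation parameter of the horospheres `H₁`, `H₂`, `H₃` centered at `P`, `Q`, `R`: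
the complex coordinate of the translation of `H₂` taking `N` to `M`, the points where `H₂` meets
the geodesics `PQ` and `QR`. -/
def IsTranslationParameter (P Q R : CuspPoint Γ) (u : ℂ) : Prop :=
  ∃ N ∈ S.horo Q ∩ geodesicLine P.1 Q.1, ∃ M ∈ S.horo Q ∩ geodesicLine Q.1 R.1,
    S.translation Q u • N = M

end CuspSections

end HypThree

end

noncomputable section

namespace HypThree

open UpperHalfSpace Filter Topology
open scoped Pointwise

/-! ### Isometries of the upper half-space -/

/-! Everything is invariant under isometries, so two distinct cusps `P`, `Q` may be moved to `∞` and
`0` with meridians `z ↦ z + 1` and `z ↦ z / (c z + 1)` for some `c ≠ 0` (`exists_normal_form_pair`).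
The normalization of lengths then puts the horospheres at height `1` and on the sphere of diameter
`1 / |c|` tangent at `0`.

Discreteness gives `1 ≤ |c|` (`one_le_norm_of_discrete`), so the two open horoballs are disjoint,
the shortest arc is the vertical segment between them, and its complex length is `log |c| + i arg c`
up to `2πi`. Hence `w = 1 / c` (`isIntercuspParameter_iff`). If instead `Q` is at `∞` and `P`, `R`
are at `a`, `b`, then `u = b - a` (`isTranslationParameter_iff`). These formulas show that the
parameters are well defined.

That they lie in the invariant trace field is read off from traces of products of squared meridians.
The product for `P` and `Q` has trace `2 + 4 c`. If `c`, `e` are the constants of the pairs `(Q, P)`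
and `(Q, R)`, inserting the square for `Q` in front of those for `P` and `R` changes the trace by `4
(c + e) + 8 c e (b - a)`. Solving gives `c`, then `b - a` (`lower_mem_invariantTraceField`,
`sub_mem_invariantTraceField`). -/

/-- The square of the Euclidean distance of two points. -/
def euclSq (p q : UpperHalfSpace) : ℝ := ‖p.z - q.z‖ ^ 2 + (p.t - q.t) ^ 2

lemma ofReal_euclSq (p q : UpperHalfSpace) : (euclSq p q : ℂ) =
    (p.z - q.z) * (star p.z - star q.z) + ((p.t : ℂ) - q.t) ^ 2 := by
  rw [← star_sub, show star (p.z - q.z) = (starRingEnd ℂ) (p.z - q.z) from rfl,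
    Complex.mul_conj, Complex.normSq_eq_norm_sq]
  simp [euclSq]

/-- Polarized form of `numer_mul_star`: expanding, the left side is the right side times `det g` and
its conjugate, both equal to `1`. It supplies the cross terms in `euclSq_smul`. -/
lemma numer_polarization (g : SL(2, ℂ)) (p q : UpperHalfSpace) :
    ((g 0 0 * p.z + g 0 1) * star (g 0 0 * p.z + g 0 1) +
        g 0 0 * star (g 0 0) * (p.t : ℂ) ^ 2) * denom g q +
      ((g 0 0 * q.z + g 0 1) * star (g 0 0 * q.z + g 0 1) +
        g 0 0 * star (g 0 0) * (q.t : ℂ) ^ 2) * denom g p -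
      numer g p * star (numer g q) - star (numer g p) * numer g q =
    (p.z - q.z) * (star p.z - star q.z) + (p.t : ℂ) ^ 2 + (q.t : ℂ) ^ 2 := by
  have h1 := det_eq g
  have h2 := star_det_eq g
  have ht : star (p.t : ℂ) = p.t := Complex.conj_ofReal _
  have ht' : star (q.t : ℂ) = q.t := Complex.conj_ofReal _
  rw [denom_coe, denom_coe]
  simp only [numer, star_add, star_mul', star_pow, star_star, ht, ht']
  have h3 : (g 0 0 * g 1 1 - g 0 1 * g 1 0) *
    (star (g 0 0) * star (g 1 1) - star (g 0 1) * star (g 1 0)) = 1 := by rw [h1, h2, one_mul]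
  linear_combination ((p.z - q.z) * (star p.z - star q.z) + (p.t : ℂ) ^ 2 + (q.t : ℂ) ^ 2) * h3

lemma euclSq_smul (g : SL(2, ℂ)) (p q : UpperHalfSpace) :
    euclSq (g • p) (g • q) = euclSq p q / (denom g p * denom g q) := by
  have hp : (denom g p : ℂ) ≠ 0 := by exact_mod_cast (denom_pos g p).ne'
  have hq : (denom g q : ℂ) ≠ 0 := by exact_mod_cast (denom_pos g q).ne'
  have hsp : star (denom g p : ℂ) = denom g p := Complex.conj_ofReal _
  have hsq : star (denom g q : ℂ) = denom g q := Complex.conj_ofReal _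
  apply Complex.ofReal_injective
  rw [ofReal_euclSq, Complex.ofReal_div, ofReal_euclSq, Complex.ofReal_mul]
  simp only [smul_z, smul_t, star_div₀, hsp, hsq, Complex.ofReal_div]
  have k1 := numer_mul_star g p
  have k2 := numer_mul_star g q
  have k3 := numer_polarization g p q
  field_simp
  generalize numer g p = n at *
  generalize numer g q = m at *
  generalize (denom g p : ℂ) = D at *
  generalize (denom g q : ℂ) = E at *
  linear_combination E ^ 2 * k1 + D ^ 2 * k2 + D * E * k3

lemma hdist_eq (p q : UpperHalfSpace) :
    hdist p q = Real.arcosh (1 + euclSq p q / (2 * p.t * q.t)) := rfl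

lemma euclSq_div_smul (g : SL(2, ℂ)) (p q : UpperHalfSpace) :
    euclSq (g • p) (g • q) / ((g • p).t * (g • q).t) = euclSq p q / (p.t * q.t) := by
  have := (denom_pos g p).ne'
  have := (denom_pos g q).ne'
  have := p.t_pos.ne'
  have := q.t_pos.ne'
  rw [euclSq_smul, smul_t, smul_t]
  field_simp

lemma hdist_smul (g : SL(2, ℂ)) (p q : UpperHalfSpace) : hdist (g • p) (g • q) = hdist p q := by
  rw [hdist_eq, hdist_eq, mul_assoc, mul_assoc, mul_comm (2 : ℝ), mul_comm (2 : ℝ),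
    ← div_div _ _ (2 : ℝ), ← div_div _ _ (2 : ℝ), euclSq_div_smul]

/-- The same `L`, the differential of `g` at `p`, serves all curves through `p`, so curves with a
common velocity keep a common velocity. Its explicit form is never needed. -/
lemma exists_hasDerivAt_smul (g : SL(2, ℂ)) (p : UpperHalfSpace) :
    ∃ L : ℂ × ℝ →L[ℝ] ℂ × ℝ, ∀ (γ : ℝ → UpperHalfSpace) (s : ℝ) (v : ℂ × ℝ), γ s = p →
      HasDerivAt (fun r ↦ (γ r).coords) v s → HasDerivAt (fun r ↦ (g • γ r).coords) (L v) s := by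
  let D : ℂ × ℝ → ℝ := fun x ↦
    Complex.normSq (g 1 0 * x.1 + g 1 1) + Complex.normSq (g 1 0) * x.2 ^ 2
  let N : ℂ × ℝ → ℂ := fun x ↦ (g 0 0 * x.1 + g 0 1) * (starRingEnd ℂ) (g 1 0 * x.1 + g 1 1) +
    g 0 0 * star (g 1 0) * (x.2 : ℂ) ^ 2
  have hD : Differentiable ℝ D := by
    simp only [D, Complex.normSq_eq_norm_sq]
    have : Differentiable ℝ fun x : ℂ × ℝ ↦ ‖g 1 0 * x.1 + g 1 1‖ ^ 2 :=
      Differentiable.norm_sq ℝ (by fun_prop)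
    fun_prop
  have hof : Differentiable ℝ fun x : ℂ × ℝ ↦ (x.2 : ℂ) :=
    Complex.ofRealCLM.differentiable.comp differentiable_snd
  have hN : Differentiable ℝ N := by
    have : Differentiable ℝ fun x : ℂ × ℝ ↦ (starRingEnd ℂ) (g 1 0 * x.1 + g 1 1) :=
      Complex.conjCLE.differentiable.comp (by fun_prop)
    fun_prop
  have hDc : Differentiable ℝ fun x ↦ (D x : ℂ) := Complex.ofRealCLM.differentiable.comp hD
  have hp : D p.coords ≠ 0 := (denom_pos g p).ne'
  have hF : DifferentiableAt ℝ (fun x : ℂ × ℝ ↦ (N x / (D x : ℂ), x.2 / D x)) p.coords := by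
    refine DifferentiableAt.prodMk ?_ ?_
    · simp only [div_eq_mul_inv]
      exact (hN _).mul ((hDc _).inv (by exact_mod_cast hp))
    · simp only [div_eq_mul_inv]
      exact differentiableAt_snd.mul ((hD _).inv hp)
  refine ⟨fderiv ℝ (fun x : ℂ × ℝ ↦ (N x / (D x : ℂ), x.2 / D x)) p.coords,
    fun γ s v hs hv ↦ ?_⟩
  subst hs
  exact hF.hasFDerivAt.comp_hasDerivAt s hv

/-- Recovers the Riemannian norm from an invariant function of pairs of points, so that
`tangentNorm_smul` follows by uniqueness of limits, without computing the differential of `g`. -/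
lemma tendsto_euclSq_div {γ : ℝ → UpperHalfSpace} {s : ℝ} {v : ℂ × ℝ}
    (h : HasDerivAt (fun r ↦ (γ r).coords) v s) :
    Tendsto (fun x ↦ euclSq (γ x) (γ s) / ((γ x).t * (γ s).t) / (x - s) ^ 2) (𝓝[≠] s)
      (𝓝 (tangentNorm (γ s) v ^ 2)) := by
  have h1 := hasDerivAt_iff_tendsto_slope.1 h
  have h2 : Tendsto (fun x ↦ (γ x).t) (𝓝[≠] s) (𝓝 (γ s).t) :=
    ((continuous_snd.tendsto _).comp h.continuousAt.tendsto).mono_left nhdsWithin_le_nhds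
  have h3 : Continuous fun w : ℂ × ℝ ↦ ‖w.1‖ ^ 2 + w.2 ^ 2 := by fun_prop
  have hts := (γ s).t_pos
  have h4 := ((h3.tendsto v).comp h1).div (h2.mul_const (γ s).t) (by positivity)
  rw [tangentNorm, div_pow, Real.sq_sqrt (by positivity), sq (γ s).t]
  refine h4.congr' ?_
  filter_upwards [self_mem_nhdsWithin] with x hx
  have hxs : x - s ≠ 0 := sub_ne_zero.2 hx
  have htx := (γ x).t_pos
  simp only [Function.comp, Pi.div_apply, slope, vsub_eq_sub, Prod.smul_fst, Prod.smul_snd,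
    Prod.fst_sub, Prod.snd_sub, norm_smul, norm_inv, Real.norm_eq_abs, mul_pow, inv_pow, sq_abs,
    smul_eq_mul, euclSq, z, t, coords]
  field_simp

lemma tangentNorm_smul (g : SL(2, ℂ)) {γ : ℝ → UpperHalfSpace} {s : ℝ} {v w : ℂ × ℝ}
    (h : HasDerivAt (fun r ↦ (γ r).coords) v s)
    (h' : HasDerivAt (fun r ↦ (g • γ r).coords) w s) :
    tangentNorm (g • γ s) w = tangentNorm (γ s) v := by
  have h1 := tendsto_euclSq_div h
  have h2 := tendsto_euclSq_div h'
  simp only [euclSq_div_smul] at h2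
  have h3 := tendsto_nhds_unique h2 h1
  have hn : ∀ (p : UpperHalfSpace) (x : ℂ × ℝ), 0 ≤ tangentNorm p x := fun p x ↦
    div_nonneg (Real.sqrt_nonneg _) p.t_pos.le
  exact (pow_left_inj₀ (hn _ _) (hn _ _) two_ne_zero).1 h3

lemma pathLength_smul (g : SL(2, ℂ)) {γ : ℝ → UpperHalfSpace}
    (h : Differentiable ℝ fun r ↦ (γ r).coords) :
    pathLength (fun s ↦ g • γ s) = pathLength γ := by
  unfold pathLength
  congr 1
  funext s
  have hs := (h s).hasDerivAt
  obtain ⟨L, hL⟩ := exists_hasDerivAt_smul g (γ s)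
  have hs' := hL γ s _ rfl hs
  rw [hs'.deriv]
  exact tangentNorm_smul g hs hs'

/-! ### Unipotent matrices -/

/-- The matrix with the given entries, as an element of `SL(2, ℂ)`. -/
def ofEntries (a b c d : ℂ) (h : a * d - b * c = 1) : SL(2, ℂ) :=
  ⟨!![a, b; c, d], by rw [Matrix.det_fin_two_of, h]⟩

section

variable (a b c d : ℂ) (h : a * d - b * c = 1)

@[simp] lemma ofEntries_zero_zero : ofEntries a b c d h 0 0 = a := rfl

@[simp] lemma ofEntries_zero_one : ofEntries a b c d h 0 1 = b := rfl

@[simp] lemma ofEntries_one_zero : ofEntries a b c d h 1 0 = c := rfl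

@[simp] lemma ofEntries_one_one : ofEntries a b c d h 1 1 = d := rfl

end

/-- The matrix of `z ↦ z + u`. -/
def upper (u : ℂ) : SL(2, ℂ) := ofEntries 1 u 0 1 (by ring)

/-- The matrix of `z ↦ z / (c z + 1)`. -/
def lower (c : ℂ) : SL(2, ℂ) := ofEntries 1 0 c 1 (by ring)

lemma upper_smul (u : ℂ) (p : UpperHalfSpace) : upper u • p = mk (p.z + u) p.t p.t_pos := by
  ext <;> simp [smul_z, smul_t, numer, denom, upper]

lemma ext_entries {A B : SL(2, ℂ)} (h00 : A 0 0 = B 0 0) (h01 : A 0 1 = B 0 1)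
    (h10 : A 1 0 = B 1 0) (h11 : A 1 1 = B 1 1) : A = B := by
  ext i j
  fin_cases i <;> fin_cases j <;> assumption

lemma upper_add (u v : ℂ) : upper (u + v) = upper u * upper v := by
  apply ext_entries <;> simp [mul_entry, upper, add_comm]

lemma upper_zero : upper 0 = 1 := by
  apply ext_entries <;> simp [upper]

lemma upper_inv (u : ℂ) : (upper u)⁻¹ = upper (-u) := by
  rw [inv_eq_iff_mul_eq_one, ← upper_add, add_neg_cancel, upper_zero]

lemma lower_pow_two (c : ℂ) : lower c ^ 2 = lower (2 * c) := by
  rw [sq]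
  apply ext_entries <;> simp [mul_entry, lower, two_mul]

lemma upper_pow_two (c : ℂ) : upper c ^ 2 = upper (2 * c) := by
  rw [sq, two_mul, upper_add]

/-! ### The action on ideal points -/

lemma moebius_mul (A B : SL(2, ℂ)) (P : OnePoint ℂ) :
    moebius (A * B) P = moebius A (moebius B P) := by
  simp [moebius, mul_smul]

lemma moebius_one (P : OnePoint ℂ) : moebius 1 P = P := by simp [moebius]

lemma moebius_inv_eq {A : SL(2, ℂ)} {P Q : OnePoint ℂ} (h : moebius A P = Q) :
    moebius A⁻¹ Q = P := by
  rw [← h, ← moebius_mul, inv_mul_cancel, moebius_one]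

lemma moebius_infty (A : SL(2, ℂ)) : moebius A OnePoint.infty =
    if A 1 0 = 0 then OnePoint.infty else ((A 0 0 / A 1 0 : ℂ) : OnePoint ℂ) := by
  rw [moebius, OnePoint.smul_infty_eq_ite]
  rfl

lemma moebius_coe (A : SL(2, ℂ)) (x : ℂ) : moebius A (x : OnePoint ℂ) =
    if A 1 0 * x + A 1 1 = 0 then OnePoint.infty
    else (((A 0 0 * x + A 0 1) / (A 1 0 * x + A 1 1) : ℂ) : OnePoint ℂ) := by
  rw [moebius, OnePoint.smul_some_eq_ite]
  rfl

lemma moebius_upper (u x : ℂ) : moebius (upper u) (x : OnePoint ℂ) = ((x + u : ℂ) : OnePoint ℂ) := by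
  rw [moebius_coe]; simp [upper]

lemma moebius_upper_infty (u : ℂ) : moebius (upper u) OnePoint.infty = OnePoint.infty := by
  rw [moebius_infty]; simp [upper]

lemma exists_moebius_infty_eq (P : OnePoint ℂ) : ∃ g : SL(2, ℂ), moebius g OnePoint.infty = P := by
  induction P using OnePoint.rec with
  | infty => exact ⟨1, moebius_one _⟩
  | coe a =>
    refine ⟨ofEntries a (-1) 1 0 (by ring), ?_⟩
    rw [moebius_infty]
    simp

lemma inv_entries (A : SL(2, ℂ)) :
    A⁻¹ 0 0 = A 1 1 ∧ A⁻¹ 0 1 = -A 0 1 ∧ A⁻¹ 1 0 = -A 1 0 ∧ A⁻¹ 1 1 = A 0 0 := by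
  simp [Matrix.SpecialLinearGroup.coe_inv, Matrix.adjugate_fin_two]

/-- The conjugate depends only on the first column of `B`; this yields the recursions `c ↦ -c²` and
`a ↦ 1 - a c` for `shimizuSeq`. -/
lemma conj_upper_entries (B : SL(2, ℂ)) (u : ℂ) :
    (B * upper u * B⁻¹) 0 0 = 1 - u * (B 0 0 * B 1 0) ∧ (B * upper u * B⁻¹) 0 1 = u * B 0 0 ^ 2 ∧
      (B * upper u * B⁻¹) 1 0 = -(u * B 1 0 ^ 2) ∧
      (B * upper u * B⁻¹) 1 1 = 1 + u * (B 0 0 * B 1 0) := by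
  obtain ⟨h1, h2, h3, h4⟩ := inv_entries B
  have hd := det_eq B
  simp only [mul_entry, upper, ofEntries_zero_zero, ofEntries_zero_one, ofEntries_one_zero,
    ofEntries_one_one, h1, h2, h3, h4]
  refine ⟨?_, ?_, ?_, ?_⟩
  · linear_combination hd
  · ring
  · ring
  · linear_combination hd

/-! ### The Shimizu–Leutbecher inequality -/

/-- The sequence obtained from `B` by repeatedly conjugating `z ↦ z + 1`. -/
def shimizuSeq (B : SL(2, ℂ)) : ℕ → SL(2, ℂ)
  | 0 => B
  | n + 1 => shimizuSeq B n * upper 1 * (shimizuSeq B n)⁻¹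

lemma shimizuSeq_one_zero_ne {B : SL(2, ℂ)} (hB : B 1 0 ≠ 0) (n : ℕ) :
    shimizuSeq B n 1 0 ≠ 0 := by
  induction n with
  | zero => exact hB
  | succ n ih =>
    rw [shimizuSeq, (conj_upper_entries _ _).2.2.1]
    simpa using ih

lemma norm_shimizuSeq_one_zero_le {B : SL(2, ℂ)} (hB : ‖B 1 0‖ ≤ 1) (n : ℕ) :
    ‖shimizuSeq B n 1 0‖ ≤ ‖B 1 0‖ ^ (n + 1) := by
  induction n with
  | zero => simp [shimizuSeq]
  | succ n ih =>
    rw [shimizuSeq, (conj_upper_entries _ _).2.2.1, one_mul, norm_neg, norm_pow]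
    calc ‖shimizuSeq B n 1 0‖ ^ 2 ≤ (‖B 1 0‖ ^ (n + 1)) ^ 2 := by gcongr
      _ = ‖B 1 0‖ ^ ((n + 1) * 2) := (pow_mul _ _ _).symm
      _ ≤ ‖B 1 0‖ ^ (n + 1 + 1) := pow_le_pow_of_le_one (norm_nonneg _) hB (by omega)

/-- Linear growth is enough: the lower left entries decay geometrically, so the products `a c` still
tend to `0`. -/
lemma norm_shimizuSeq_zero_zero_le {B : SL(2, ℂ)} (hB : ‖B 1 0‖ ≤ 1) (n : ℕ) :
    ‖shimizuSeq B n 0 0‖ ≤ n + ‖B 0 0‖ + 1 := by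
  induction n with
  | zero => simp [shimizuSeq]
  | succ n ih =>
    rw [shimizuSeq, (conj_upper_entries _ _).1, one_mul]
    have h1 : ‖shimizuSeq B n 1 0‖ ≤ 1 :=
      (norm_shimizuSeq_one_zero_le hB n).trans (pow_le_one₀ (norm_nonneg _) hB)
    calc ‖1 - shimizuSeq B n 0 0 * shimizuSeq B n 1 0‖
        ≤ ‖(1 : ℂ)‖ + ‖shimizuSeq B n 0 0 * shimizuSeq B n 1 0‖ := norm_sub_le _ _
      _ ≤ 1 + ‖shimizuSeq B n 0 0‖ * 1 := by rw [norm_mul, norm_one]; gcongr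
      _ ≤ ((n + 1 : ℕ) : ℝ) + ‖B 0 0‖ + 1 := by push_cast; linarith

lemma tendsto_shimizuSeq {B : SL(2, ℂ)} (hB : ‖B 1 0‖ < 1) :
    Tendsto (fun n ↦ shimizuSeq B (n + 1)) atTop (𝓝 (upper 1)) := by
  have hc : Tendsto (fun n ↦ shimizuSeq B n 1 0) atTop (𝓝 0) :=
    squeeze_zero_norm (norm_shimizuSeq_one_zero_le hB.le)
      ((tendsto_pow_atTop_nhds_zero_of_lt_one (norm_nonneg _) hB).comp (tendsto_add_atTop_nat 1))
  have hac : Tendsto (fun n ↦ shimizuSeq B n 0 0 * shimizuSeq B n 1 0) atTop (𝓝 0) := by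
    have h1 := tendsto_self_mul_const_pow_of_lt_one (norm_nonneg _) hB
    have h2 := (tendsto_pow_atTop_nhds_zero_of_lt_one (norm_nonneg _) hB).const_mul (‖B 0 0‖ + 1)
    have h3 := (h1.add h2).mul_const ‖B 1 0‖
    simp only [mul_zero, add_zero, zero_mul] at h3
    refine squeeze_zero_norm (fun n ↦ ?_) h3
    rw [norm_mul]
    calc ‖shimizuSeq B n 0 0‖ * ‖shimizuSeq B n 1 0‖
        ≤ (n + ‖B 0 0‖ + 1) * ‖B 1 0‖ ^ (n + 1) := by
          gcongr
          · exact norm_shimizuSeq_zero_zero_le hB.le n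
          · exact norm_shimizuSeq_one_zero_le hB.le n
      _ = _ := by ring
  have ha' : Tendsto (fun n ↦ shimizuSeq B (n + 1) 0 0) atTop (𝓝 1) := by
    simp only [shimizuSeq, (conj_upper_entries _ _).1, one_mul]
    simpa using hac.const_sub 1
  have ha : Tendsto (fun n ↦ shimizuSeq B n 0 0) atTop (𝓝 1) := (tendsto_add_atTop_iff_nat 1).1 ha'
  have hd' : Tendsto (fun n ↦ shimizuSeq B (n + 1) 1 1) atTop (𝓝 1) := by
    simp only [shimizuSeq, (conj_upper_entries _ _).2.2.2, one_mul]
    simpa using hac.const_add 1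
  have hb' : Tendsto (fun n ↦ shimizuSeq B (n + 1) 0 1) atTop (𝓝 1) := by
    simp only [shimizuSeq, (conj_upper_entries _ _).2.1, one_mul]
    simpa using ha.pow 2
  have hc' := hc.comp (tendsto_add_atTop_nat 1)
  refine tendsto_subtype_rng.2 (tendsto_pi_nhds.2 fun i ↦ tendsto_pi_nhds.2 fun j ↦ ?_)
  fin_cases i <;> fin_cases j
  · exact ha'
  · exact hb'
  · exact hc'
  · exact hd'

/-- Matrices with the same class differ by a central, hence scalar, matrix. -/
lemma one_zero_eq_zero_of_coe_eq_coe {A B : SL(2, ℂ)} (h : (A : PSL(2, ℂ)) = B) (hA : A 1 0 = 0) :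
    B 1 0 = 0 := by
  have h1 := QuotientGroup.eq.1 h
  have h2 := Matrix.SpecialLinearGroup.scalar_eq_self_of_mem_center h1 0
  have h10 : (A⁻¹ * B) 1 0 = 0 := by simpa using (congrFun (congrFun h2 1) 0).symm
  have : B = A * (A⁻¹ * B) := by group
  rw [this, mul_entry, hA, h10]
  ring

/-- **Shimizu–Leutbecher**: in a discrete group containing `z ↦ z + 1` (up to conjugation), the
lower left entry of a matrix is `0` or of norm at least `1`. -/
theorem one_le_norm_of_discrete {Γ : Subgroup PSL(2, ℂ)} (hΓ : DiscreteTopology Γ)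
    (g B : SL(2, ℂ)) (hU : ((g * upper 1 * g⁻¹ : SL(2, ℂ)) : PSL(2, ℂ)) ∈ Γ)
    (hBΓ : ((g * B * g⁻¹ : SL(2, ℂ)) : PSL(2, ℂ)) ∈ Γ) (hB : B 1 0 ≠ 0) : 1 ≤ ‖B 1 0‖ := by
  by_contra! hlt
  have hmem : ∀ n, ((g * shimizuSeq B n * g⁻¹ : SL(2, ℂ)) : PSL(2, ℂ)) ∈ Γ := by
    intro n
    induction n with
    | zero => exact hBΓ
    | succ n ih =>
      have h := Γ.mul_mem (Γ.mul_mem ih hU) (Γ.inv_mem ih)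
      rw [← QuotientGroup.mk_inv, ← QuotientGroup.mk_mul, ← QuotientGroup.mk_mul] at h
      convert h using 2
      rw [shimizuSeq]
      group
  have hlim : Tendsto (fun n ↦ ((g * shimizuSeq B (n + 1) * g⁻¹ : SL(2, ℂ)) : PSL(2, ℂ))) atTop
      (𝓝 ((g * upper 1 * g⁻¹ : SL(2, ℂ)) : PSL(2, ℂ))) :=
    (continuous_quotient_mk'.tendsto _).comp
      (((tendsto_shimizuSeq hlt).const_mul g).mul_const g⁻¹)
  have hlim' : Tendsto (fun n ↦ (⟨_, hmem (n + 1)⟩ : Γ)) atTop (𝓝 ⟨_, hU⟩) :=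
    tendsto_subtype_rng.2 hlim
  -- A convergent sequence in a discrete space is eventually equal to its limit. Here the limit
  -- fixes the image of `∞` under `g`, while no term does, since the lower left entries stay
  -- nonzero.
  rw [nhds_discrete, tendsto_pure] at hlim'
  obtain ⟨n, hn⟩ := hlim'.exists
  have hn' := congrArg Subtype.val hn
  simp only [QuotientGroup.mk_mul] at hn'
  exact shimizuSeq_one_zero_ne hB (n + 1)
    (one_zero_eq_zero_of_coe_eq_coe (mul_left_cancel (mul_right_cancel hn')).symm rfl)

/-! ### Normal forms of the meridians and of the horospheres -/

lemma coe_horoTranslation {A : SL(2, ℂ)} (hA : (A : Matrix (Fin 2) (Fin 2) ℂ).trace = 2) (u : ℂ) :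
    (horoTranslation A hA u : Matrix (Fin 2) (Fin 2) ℂ) =
      1 + u • ((A : Matrix (Fin 2) (Fin 2) ℂ) - 1) := rfl

lemma horoTranslation_conj {A B g : SL(2, ℂ)} (hAB : A = g * B * g⁻¹)
    (hA : (A : Matrix (Fin 2) (Fin 2) ℂ).trace = 2)
    (hB : (B : Matrix (Fin 2) (Fin 2) ℂ).trace = 2) (u : ℂ) :
    horoTranslation A hA u = g * horoTranslation B hB u * g⁻¹ := by
  subst hAB
  have hg : (g : Matrix (Fin 2) (Fin 2) ℂ) * (g⁻¹ : SL(2, ℂ)) = 1 := by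
    rw [← Matrix.SpecialLinearGroup.coe_mul, mul_inv_cancel, Matrix.SpecialLinearGroup.coe_one]
  apply Subtype.ext
  simp only [coe_horoTranslation, Matrix.SpecialLinearGroup.coe_mul, mul_add, add_mul, mul_one, hg,
    Matrix.mul_smul, Matrix.smul_mul, mul_sub, sub_mul]

lemma trace_upper (c : ℂ) : (upper c : Matrix (Fin 2) (Fin 2) ℂ).trace = 2 := by
  rw [Matrix.trace_fin_two]; norm_num [upper]

lemma trace_lower (c : ℂ) : (lower c : Matrix (Fin 2) (Fin 2) ℂ).trace = 2 := by
  rw [Matrix.trace_fin_two]; norm_num [lower]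

lemma horoTranslation_entry {A : SL(2, ℂ)} (hA : (A : Matrix (Fin 2) (Fin 2) ℂ).trace = 2) (u : ℂ)
    (i j : Fin 2) : horoTranslation A hA u i j =
      (1 : Matrix (Fin 2) (Fin 2) ℂ) i j + u * (A i j - (1 : Matrix (Fin 2) (Fin 2) ℂ) i j) := rfl

lemma horoTranslation_upper (c u : ℂ) :
    horoTranslation (upper c) (trace_upper c) u = upper (c * u) := by
  apply ext_entries <;> rw [horoTranslation_entry] <;> simp [upper, mul_comm]

lemma horoTranslation_lower (c u : ℂ) :
    horoTranslation (lower c) (trace_lower c) u = lower (c * u) := by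
  apply ext_entries <;> rw [horoTranslation_entry] <;> simp [lower, mul_comm]

lemma pathLength_horizontal {r : ℝ} (hr : 0 < r) : pathLength (fun s ↦ mk (s : ℂ) r hr) = 1 / r := by
  have h : ∀ s : ℝ, HasDerivAt (fun s : ℝ ↦ (mk (s : ℂ) r hr).coords) ((1 : ℂ), (0 : ℝ)) s :=
    fun s ↦ (Complex.ofRealCLM.hasDerivAt (x := s)).prodMk (hasDerivAt_const s r)
  unfold pathLength
  simp [(h _).deriv, tangentNorm]

/-- For `P = a` finite, `denom g⁻¹ p` is `|g 1 0|² (|z - a|² + t²)`, so constant height of `g⁻¹ • p`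
is exactly the equation of a sphere tangent at `a`. -/
lemma exists_eq_smul_of_isHorosphere {H : Set UpperHalfSpace} {P : OnePoint ℂ}
    (hH : IsHorosphere H P) {g : SL(2, ℂ)} (hg : moebius g OnePoint.infty = P) :
    ∃ r : ℝ, 0 < r ∧ H = g • {p | p.t = r} := by
  obtain ⟨i1, i2, i3, i4⟩ := inv_entries g
  have hd := det_eq g
  rw [moebius_infty] at hg
  obtain ⟨r, hr, ⟨rfl, rfl⟩ | ⟨a, rfl, rfl⟩⟩ := hH
  · have hc : g 1 0 = 0 := by
      by_contra hc
      simp [hc] at hg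
    have ha : g 0 0 ≠ 0 := by
      intro ha
      simp [ha, hc] at hd
    have hn := Complex.normSq_pos.2 ha
    refine ⟨r / Complex.normSq (g 0 0), by positivity, ?_⟩
    ext p
    rw [Set.mem_smul_set_iff_inv_smul_mem, Set.mem_ofPred_eq, Set.mem_ofPred_eq, smul_t, denom, i3,
      i4, hc]
    simp [div_left_inj' hn.ne']
  · have hc : g 1 0 ≠ 0 := by
      intro hc
      simp [hc] at hg
    have ha : g 0 0 = a * g 1 0 := by
      simp only [hc, if_false, OnePoint.coe_eq_coe] at hg
      rw [← hg, div_mul_cancel₀ _ hc]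
    have hn := Complex.normSq_pos.2 hc
    refine ⟨1 / (r * Complex.normSq (g 1 0)), by positivity, ?_⟩
    ext p
    have ht := p.t_pos
    have hE : 0 < ‖p.z - a‖ ^ 2 + p.t ^ 2 := by positivity
    have hden : denom g⁻¹ p = Complex.normSq (g 1 0) * (‖p.z - a‖ ^ 2 + p.t ^ 2) := by
      rw [denom, i3, i4, ha, show -g 1 0 * p.z + a * g 1 0 = -g 1 0 * (p.z - a) by ring,
        Complex.normSq_mul, Complex.normSq_neg, Complex.normSq_eq_norm_sq (p.z - a)]
      ring
    rw [Set.mem_smul_set_iff_inv_smul_mem, Set.mem_ofPred_eq, Set.mem_ofPred_eq, smul_t, hden,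
      div_eq_div_iff (by positivity) (by positivity)]
    constructor
    · intro h
      rw [h]
      ring
    · intro h
      have := mul_left_cancel₀ hn.ne' (show Complex.normSq (g 1 0) * (‖p.z - a‖ ^ 2 + p.t ^ 2) =
        Complex.normSq (g 1 0) * (r * p.t) by linear_combination -h)
      exact this

namespace CuspSections

variable {Γ : Subgroup PSL(2, ℂ)} (S : CuspSections Γ)

lemma translation_eq_upper {P : CuspPoint Γ} {g : SL(2, ℂ)} {c : ℂ}
    (h : S.mer P = g * upper c * g⁻¹) (u : ℂ) :
    S.translation P u = g * upper (c * u) * g⁻¹ := by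
  rw [translation, horoTranslation_conj h _ (trace_upper c), horoTranslation_upper]

lemma translation_eq_lower {P : CuspPoint Γ} {g : SL(2, ℂ)} {c : ℂ}
    (h : S.mer P = g * lower c * g⁻¹) (u : ℂ) :
    S.translation P u = g * lower (c * u) * g⁻¹ := by
  rw [translation, horoTranslation_conj h _ (trace_lower c), horoTranslation_lower]

/-- Fixing `∞` makes the conjugated meridian upper triangular; trace `2` and determinant `1` make
both diagonal entries `1`. -/
lemma exists_mer_eq_upper {P : CuspPoint Γ} {h : SL(2, ℂ)} (hP : moebius h OnePoint.infty = P.1) :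
    ∃ b : ℂ, b ≠ 0 ∧ S.mer P = h * upper b * h⁻¹ := by
  set B := h⁻¹ * S.mer P * h with hB
  have hmer : S.mer P = h * B * h⁻¹ := by rw [hB]; group
  have hfix : moebius B OnePoint.infty = OnePoint.infty := by
    rw [hB, moebius_mul, moebius_mul, hP, S.mer_fix, moebius_inv_eq hP]
  have h10 : B 1 0 = 0 := by
    rw [moebius_infty] at hfix
    by_contra hc
    simp [hc] at hfix
  have htr : B 0 0 + B 1 1 = 2 := by
    have h1 := S.mer_trace P
    rw [hmer, Matrix.SpecialLinearGroup.coe_mul, Matrix.trace_mul_comm,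
      ← Matrix.SpecialLinearGroup.coe_mul, ← mul_assoc, inv_mul_cancel, one_mul,
      Matrix.trace_fin_two] at h1
    exact h1
  have hd := det_eq B
  have h00 : B 0 0 = 1 := by
    have : (B 0 0 - 1) ^ 2 = 0 := by
      rw [h10] at hd
      linear_combination -hd + B 0 0 * htr
    linear_combination pow_eq_zero_iff two_ne_zero |>.1 this
  have hBu : B = upper (B 0 1) := by
    apply ext_entries <;> simp only [upper, ofEntries_zero_zero, ofEntries_zero_one,
      ofEntries_one_zero, ofEntries_one_one]
    · exact h00
    · exact h10
    · linear_combination htr - h00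
  refine ⟨B 0 1, fun h0 ↦ S.mer_ne_one P ?_, by rw [← hBu, hmer]⟩
  rw [hmer, hBu, h0, upper_zero, mul_one, mul_inv_cancel]

/-- A cusp can be moved to `∞` so that the meridian becomes the translation by `1`; the
horosphere is then at height `1`. -/
lemma exists_normal_form (P : CuspPoint Γ) : ∃ g : SL(2, ℂ), moebius g OnePoint.infty = P.1 ∧
    S.mer P = g * upper 1 * g⁻¹ ∧ S.horo P = g • {p | p.t = 1} := by
  obtain ⟨h, hh⟩ := exists_moebius_infty_eq P.1
  obtain ⟨b, hb, hmer⟩ := S.exists_mer_eq_upper hh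
  -- The diagonal matrix with entries `m`, `m⁻¹` acts on `ℂ` as `z ↦ m² z`, so it conjugates
  -- translation by `1` to translation by `b = m²`.
  obtain ⟨m, hm⟩ := IsAlgClosed.exists_pow_nat_eq b (n := 2) two_pos
  have hm0 : m ≠ 0 := by
    rintro rfl
    exact hb (by simpa using hm.symm)
  set D : SL(2, ℂ) := ofEntries m 0 0 m⁻¹ (by simp [hm0]) with hD
  have hDU : D * upper 1 = upper b * D := by
    apply ext_entries <;> simp [mul_entry, hD, upper, ← hm, sq, hm0]
  have hg : moebius (h * D) OnePoint.infty = P.1 := by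
    rw [moebius_mul, ← hh, moebius_infty D]
    simp [hD]
  have hmer' : S.mer P = h * D * upper 1 * (h * D)⁻¹ := by
    rw [mul_assoc h, hDU, hmer]
    group
  obtain ⟨r, hr, hH⟩ := exists_eq_smul_of_isHorosphere (S.horo_isHorosphere P) hg
  refine ⟨h * D, hg, hmer', ?_⟩
  have hmem : (h * D) • UpperHalfSpace.mk 0 r hr ∈ S.horo P := by
    rw [hH]
    exact Set.smul_mem_smul_set rfl
  have hlen := S.mer_length P _ hmem
  have hpath : (fun s : ℝ ↦ horoTranslation (S.mer P) (S.mer_trace P) s •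
      (h * D) • UpperHalfSpace.mk 0 r hr) =
      fun s : ℝ ↦ (h * D) • UpperHalfSpace.mk (s : ℂ) r hr := by
    funext s
    have := S.translation_eq_upper hmer' s
    rw [translation, one_mul] at this
    rw [this, mul_smul, inv_smul_smul, mul_smul, upper_smul]
    simp
  have hdiff : Differentiable ℝ fun s : ℝ ↦ (UpperHalfSpace.mk (s : ℂ) r hr).coords :=
    Complex.ofRealCLM.differentiable.prodMk (differentiable_const r)
  -- At height `r` the unit translation has length `1 / r`, so the normalization forces `r = 1`.
  rw [hpath, pathLength_smul _ hdiff, pathLength_horizontal] at hlen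
  have hr1 : r = 1 := by
    field_simp at hlen
    exact hlen.symm
  rw [hH, hr1]

/-- Compare `g` with a normalizing matrix `k`: `m = g⁻¹ k` sends `∞` to `0`, so `m 0 0 = 0`. Both
the meridian constant `c = -(m 1 0)²` and the diameter `1 / |m 1 0|²` come from the same entry,
which ties the diameter to `c`. -/
lemma exists_normal_form_zero (Q : CuspPoint Γ) {g : SL(2, ℂ)}
    (hg : moebius g ((0 : ℂ) : OnePoint ℂ) = Q.1) : ∃ c : ℂ, c ≠ 0 ∧
      S.mer Q = g * lower c * g⁻¹ ∧ S.horo Q = g • {p | ‖p.z‖ ^ 2 + p.t ^ 2 = p.t / ‖c‖} := by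
  obtain ⟨k, hk, hmer, hH⟩ := S.exists_normal_form Q
  set m := g⁻¹ * k with hm
  have hkm : k = g * m := by rw [hm]; group
  have hm0 : moebius m OnePoint.infty = ((0 : ℂ) : OnePoint ℂ) := by
    rw [hm, moebius_mul, hk, moebius_inv_eq hg]
  rw [moebius_infty] at hm0
  have hc : m 1 0 ≠ 0 := by
    intro hc
    simp [hc] at hm0
  have ha : m 0 0 = 0 := by
    simpa only [hc, if_false, OnePoint.coe_eq_coe, div_eq_zero_iff, or_false] using hm0
  have hl : m * upper 1 * m⁻¹ = lower (-m 1 0 ^ 2) := by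
    obtain ⟨h1, h2, h3, h4⟩ := conj_upper_entries m 1
    apply ext_entries
    · rw [h1, ha]; simp [lower]
    · rw [h2, ha]; simp [lower]
    · rw [h3]; simp [lower]
    · rw [h4, ha]; simp [lower]
  refine ⟨-m 1 0 ^ 2, by simpa using hc, ?_, ?_⟩
  · rw [hmer, ← hl, hkm]
    group
  · rw [hH, hkm, mul_smul]
    congr 1
    ext p
    obtain ⟨i1, i2, i3, i4⟩ := inv_entries m
    have ht := p.t_pos
    have hn : 0 < ‖m 1 0‖ := norm_pos_iff.2 hc
    rw [Set.mem_smul_set_iff_inv_smul_mem, Set.mem_ofPred_eq, Set.mem_ofPred_eq, smul_t, denom, i3,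
      i4, ha, add_zero, neg_mul, Complex.normSq_neg, Complex.normSq_neg, Complex.normSq_mul,
      Complex.normSq_eq_norm_sq, Complex.normSq_eq_norm_sq, norm_neg, norm_pow, ← mul_add,
      div_eq_one_iff_eq (by positivity), eq_div_iff (by positivity), mul_comm, eq_comm]

end CuspSections

/-! ### The complex distance of two horospheres -/

/-- The complex distance of two horospheres `H₁`, `H₂`, on which the translations with complex
coordinate `u` are `τ₁ u`, `τ₂ u`, is `d + iθ`. -/
def IsComplexDistanceBetween (H₁ H₂ : Set UpperHalfSpace) (τ₁ τ₂ : ℂ → SL(2, ℂ)) (d θ : ℝ) : Prop :=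
  ∃ p ∈ H₁, ∃ q ∈ H₂, (∀ p' ∈ H₁, ∀ q' ∈ H₂, hdist p q ≤ hdist p' q') ∧ d = hdist p q ∧
    ∃ (T : SL(2, ℂ)) (v : ℂ × ℝ), IsTransvection T p q ∧
      HasDerivAt (fun s : ℝ ↦ (T • τ₁ s • p).coords) v 0 ∧
      HasDerivAt (fun s : ℝ ↦ (τ₂ (s * Complex.exp (-(θ * Complex.I))) • q).coords) v 0

lemma IsTransvection.conj {T : SL(2, ℂ)} {p q : UpperHalfSpace} (h : IsTransvection T p q)
    (g : SL(2, ℂ)) : IsTransvection (g * T * g⁻¹) (g • p) (g • q) := by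
  obtain ⟨k, D, l, hl, hD, rfl, rfl, rfl⟩ := h
  refine ⟨g * k, D, l, hl, hD, by group, (mul_smul _ _ _).symm, ?_⟩
  simp only [mul_smul, inv_smul_smul]

lemma IsTransvection.smul_eq {T : SL(2, ℂ)} {p q : UpperHalfSpace} (h : IsTransvection T p q) :
    T • p = q := by
  obtain ⟨_, _, _, _, _, _, _, h⟩ := h
  exact h

lemma IsComplexDistanceBetween.smul {H₁ H₂ : Set UpperHalfSpace} {τ₁ τ₂ : ℂ → SL(2, ℂ)} {d θ : ℝ}
    (h : IsComplexDistanceBetween H₁ H₂ τ₁ τ₂ d θ) (h₁ : τ₁ 0 = 1) (h₂ : τ₂ 0 = 1) (g : SL(2, ℂ)) :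
    IsComplexDistanceBetween (g • H₁) (g • H₂) (fun u ↦ g * τ₁ u * g⁻¹) (fun u ↦ g * τ₂ u * g⁻¹)
      d θ := by
  obtain ⟨p, hp, q, hq, hmin, hd, T, v, hT, hv₁, hv₂⟩ := h
  obtain ⟨L, hL⟩ := exists_hasDerivAt_smul g q
  refine ⟨g • p, Set.smul_mem_smul_set hp, g • q, Set.smul_mem_smul_set hq, ?_,
    by rw [hdist_smul, hd], g * T * g⁻¹, L v, hT.conj g, ?_, ?_⟩
  · rintro _ ⟨p', hp', rfl⟩ _ ⟨q', hq', rfl⟩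
    simp only [hdist_smul]
    exact hmin p' hp' q' hq'
  · have := hL _ 0 v (by simp [h₁, hT.smul_eq]) hv₁
    simpa only [mul_smul, inv_smul_smul] using this
  · have := hL _ 0 v (by simp [h₂]) hv₂
    simpa only [mul_smul, inv_smul_smul] using this

lemma isComplexDistanceBetween_smul_iff {H₁ H₂ : Set UpperHalfSpace} {τ₁ τ₂ : ℂ → SL(2, ℂ)}
    {d θ : ℝ} (h₁ : τ₁ 0 = 1) (h₂ : τ₂ 0 = 1) (g : SL(2, ℂ)) :
    IsComplexDistanceBetween (g • H₁) (g • H₂) (fun u ↦ g * τ₁ u * g⁻¹) (fun u ↦ g * τ₂ u * g⁻¹)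
      d θ ↔ IsComplexDistanceBetween H₁ H₂ τ₁ τ₂ d θ := by
  refine ⟨fun h ↦ ?_, fun h ↦ h.smul h₁ h₂ g⟩
  have := h.smul (by simp [h₁]) (by simp [h₂]) g⁻¹
  simpa only [inv_smul_smul, inv_inv, mul_assoc, inv_mul_cancel_left, inv_mul_cancel,
    mul_one] using this

/-! ### Transvections along the vertical axis. -/

/-- The transvection taking `(0, 1)` to `(0, ρ²)`. -/
def scaling (ρ : ℝ) (hρ : 0 < ρ) : SL(2, ℂ) :=
  ofEntries ρ 0 0 (ρ : ℂ)⁻¹ (by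
    have : (ρ : ℂ) ≠ 0 := by exact_mod_cast hρ.ne'
    field_simp
    ring)

lemma scaling_smul (ρ : ℝ) (hρ : 0 < ρ) (p : UpperHalfSpace) :
    scaling ρ hρ • p = mk (ρ ^ 2 * p.z) (ρ ^ 2 * p.t) (mul_pos (by positivity) p.t_pos) := by
  have : (ρ : ℂ) ≠ 0 := by exact_mod_cast hρ.ne'
  ext
  · simp [smul_z, numer, denom, scaling, Complex.normSq_ofReal]
    field_simp
  · simp [smul_t, denom, scaling, Complex.normSq_ofReal]
    field_simp

lemma isTransvection_scaling {ρ : ℝ} (hρ : 0 < ρ) {r : ℝ} (hr : 0 < r) (h : ρ ^ 2 = r) :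
    IsTransvection (scaling ρ hρ) (mk 0 1 one_pos) (mk 0 r hr) := by
  refine ⟨1, scaling ρ hρ, ρ, hρ, rfl, by simp, by simp, ?_⟩
  rw [scaling_smul]
  ext <;> simp [h]

/-- The stabilizer of `(0, 1)` is `SU(2)`. -/
lemma entries_of_smul_eq {k : SL(2, ℂ)}
    (h : mk 0 1 one_pos = k • mk 0 1 one_pos) : k 1 1 = star (k 0 0) ∧ k 1 0 = -star (k 0 1) := by
  have hd := det_eq k
  have hden : denom k (mk 0 1 one_pos) = 1 := by
    have := congrArg UpperHalfSpace.t h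
    rw [smul_t, t_mk, eq_div_iff (denom_pos _ _).ne'] at this
    linarith
  have hnum : numer k (mk 0 1 one_pos) = 0 := by
    have := congrArg UpperHalfSpace.z h
    rw [smul_z, hden] at this
    simpa using this.symm
  have h1 := denom_coe k (mk 0 1 one_pos)
  rw [hden] at h1
  simp only [z_mk, t_mk, mul_zero, zero_add, Complex.ofReal_one, one_pow, mul_one] at h1
  simp only [numer, z_mk, t_mk, mul_zero, zero_add, Complex.ofReal_one, one_pow, mul_one] at hnum
  have e1 : k 0 0 = star (k 1 1) := by
    linear_combination k 0 0 * h1 + k 1 0 * hnum + star (k 1 1) * hd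
  have e2 : k 0 1 = -star (k 1 0) := by
    linear_combination k 0 1 * h1 + k 1 1 * hnum - star (k 1 0) * hd
  rw [e1, e2]
  simp

/-- Uniqueness of the transvection: the conjugating matrix is in `SU(2)`, so `T` is Hermitian with
positive trace `l + l⁻¹`. That `T` keeps `(0, 1)` on the vertical axis says that trace times `T 0 1`
vanishes, so `T` is diagonal, with entries fixed by `r` and positivity. -/
lemma IsTransvection.eq_scaling {T : SL(2, ℂ)} {r : ℝ} {hr : 0 < r}
    (h : IsTransvection T (mk 0 1 one_pos) (mk 0 r hr)) {ρ : ℝ} (hρ : 0 < ρ) (hρr : ρ ^ 2 = r) :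
    T = scaling ρ hρ := by
  obtain ⟨k, D, l, hl, hD, hT, hk, hTq⟩ := h
  obtain ⟨h11, h10⟩ := entries_of_smul_eq hk
  obtain ⟨i1, i2, i3, i4⟩ := inv_entries k
  have hD' : ∀ i j, D i j = !![(l : ℂ), 0; 0, (l : ℂ)⁻¹] i j := fun i j ↦ by rw [← hD]
  set x : ℝ := Complex.normSq (k 0 0) with hx
  set y : ℝ := Complex.normSq (k 0 1) with hy
  have hxs : (x : ℂ) = k 0 0 * star (k 0 0) := (Complex.mul_conj _).symm
  have hys : (y : ℂ) = k 0 1 * star (k 0 1) := (Complex.mul_conj _).symm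
  have hxy : x + y = 1 := by
    have hd := det_eq k
    rw [h11, h10] at hd
    apply Complex.ofReal_injective
    push_cast
    linear_combination hd + hxs + hys
  have hx0 : 0 ≤ x := Complex.normSq_nonneg _
  have hy0 : 0 ≤ y := Complex.normSq_nonneg _
  have T00 : T 0 0 = ((l * x + l⁻¹ * y : ℝ) : ℂ) := by
    simp only [hT, mul_entry, hD', i1, i3, h11, h10]
    push_cast
    rw [hxs, hys]
    simp
    ring
  have T11 : T 1 1 = ((l * y + l⁻¹ * x : ℝ) : ℂ) := by
    simp only [hT, mul_entry, hD', i2, i4, h11, h10]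
    push_cast
    rw [hxs, hys]
    simp
    ring
  have T10 : T 1 0 = star (T 0 1) := by
    simp only [hT, mul_entry, hD', i1, i2, i3, i4, h11, h10]
    simp
    ring
  have hl' := inv_pos.2 hl
  have hz := congrArg UpperHalfSpace.z hTq
  have ht := congrArg UpperHalfSpace.t hTq
  rw [smul_z, z_mk, div_eq_zero_iff, or_iff_left (by exact_mod_cast (denom_pos _ _).ne')] at hz
  have T01 : T 0 1 = 0 := by
    have hstar : star (T 1 1) = T 1 1 := by
      rw [T11]
      exact Complex.conj_ofReal _
    simp only [numer, z_mk, t_mk, mul_zero, zero_add, Complex.ofReal_one, one_pow, mul_one,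
      hstar, T10, star_star] at hz
    have hsum : T 0 0 + T 1 1 ≠ 0 := by
      rw [T00, T11, ← Complex.ofReal_add, show l * x + l⁻¹ * y + (l * y + l⁻¹ * x) = l + l⁻¹ by
        linear_combination (l + l⁻¹) * hxy]
      exact_mod_cast (add_pos hl hl').ne'
    exact (mul_eq_zero.1 (show T 0 1 * (T 0 0 + T 1 1) = 0 by
      linear_combination hz)).resolve_right hsum
  rw [T01, star_zero] at T10
  have hw : l * y + l⁻¹ * x = ρ⁻¹ := by
    rw [smul_t, denom, T10, T11] at ht
    simp only [t_mk, z_mk, map_zero, mul_zero, zero_mul, zero_add, add_zero,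
      Complex.normSq_ofReal] at ht
    have hpos : 0 ≤ l * y + l⁻¹ * x := by positivity
    generalize l * y + l⁻¹ * x = w at *
    have hw0 : w ≠ 0 := by
      rintro rfl
      simp at ht
      exact hr.ne ht
    have : w ^ 2 = ρ⁻¹ ^ 2 := by
      rw [inv_pow, hρr, ← ht]
      field_simp
    exact (pow_left_inj₀ hpos (inv_pos.2 hρ).le two_ne_zero).1 this
  rw [hw] at T11
  have hρc : (ρ : ℂ) ≠ 0 := by exact_mod_cast hρ.ne'
  apply ext_entries
  · have hd := det_eq T
    rw [T01, T11, zero_mul, sub_zero, Complex.ofReal_inv] at hd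
    exact (mul_inv_eq_one₀ hρc).1 hd
  · exact T01
  · exact T10
  · rw [T11, Complex.ofReal_inv]; rfl

/-! ### The shortest arc between the normalized horospheres. -/

lemma hdist_eq_arcosh_add_half (p q : UpperHalfSpace) :
    hdist p q = Real.arcosh (1 + euclSq p q / (p.t * q.t) / 2) := by
  rw [hdist_eq, div_div, mul_assoc, mul_comm (2 : ℝ)]

lemma euclSq_div_nonneg (p q : UpperHalfSpace) : 0 ≤ euclSq p q / (p.t * q.t) := by
  have := p.t_pos
  have := q.t_pos
  unfold euclSq
  positivity

lemma hdist_le_hdist_iff (p q p' q' : UpperHalfSpace) : hdist p q ≤ hdist p' q' ↔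
    euclSq p q / (p.t * q.t) ≤ euclSq p' q' / (p'.t * q'.t) := by
  have := euclSq_div_nonneg p q
  have := euclSq_div_nonneg p' q'
  rw [hdist_eq_arcosh_add_half, hdist_eq_arcosh_add_half,
    Real.arcosh_le_arcosh (by positivity) (by positivity)]
  constructor <;> intro <;> linarith

lemma euclSq_div_vertical {r : ℝ} (hr : 0 < r) :
    euclSq (mk 0 1 one_pos) (mk 0 r hr) / ((mk 0 1 one_pos).t * (mk 0 r hr).t) =
      (1 - r) ^ 2 / r := by
  simp [euclSq]

lemma hdist_vertical {r : ℝ} (hr : 0 < r) (hr1 : r ≤ 1) :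
    hdist (mk 0 1 one_pos) (mk 0 r hr) = Real.log r⁻¹ := by
  rw [hdist_eq_arcosh_add_half, euclSq_div_vertical,
    ← Real.arcosh_cosh (Real.log_nonneg ((one_le_inv₀ hr).2 hr1)), Real.cosh_log (inv_pos.2 hr)]
  congr 1
  field_simp
  ring

lemma le_euclSq_div {r : ℝ} (hr : 0 < r) (hr1 : r ≤ 1) {p q : UpperHalfSpace} (hp : p.t = 1)
    (hq : ‖q.z‖ ^ 2 + q.t ^ 2 = q.t * r) : (1 - r) ^ 2 / r ≤ euclSq p q / (p.t * q.t) := by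
  have ht := q.t_pos
  have htr : q.t ≤ r := by nlinarith [sq_nonneg ‖q.z‖]
  rw [hp, one_mul, div_le_div_iff₀ hr ht, euclSq, hp]
  -- This product is `(1 - q.t)² r - (1 - r)² q.t`, the vertical part of the inequality; it is
  -- nonnegative because `q.t ≤ r ≤ 1`.
  have h1 : 0 ≤ (r - q.t) * (1 - r * q.t) := mul_nonneg (by linarith) (by nlinarith)
  nlinarith [mul_nonneg (sq_nonneg ‖p.z - q.z‖) hr.le]

lemma eq_of_euclSq_div_le {r : ℝ} (hr : 0 < r) (hr1 : r ≤ 1) {p q : UpperHalfSpace} (hp : p.t = 1)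
    (hq : ‖q.z‖ ^ 2 + q.t ^ 2 = q.t * r) (h : euclSq p q / (p.t * q.t) ≤ (1 - r) ^ 2 / r) :
    p = mk 0 1 one_pos ∧ q = mk 0 r hr := by
  have ht := q.t_pos
  have htr : q.t ≤ r := by nlinarith [sq_nonneg ‖q.z‖]
  rw [hp, one_mul, div_le_div_iff₀ ht hr, euclSq, hp] at h
  have h1 : 0 ≤ (r - q.t) * (1 - r * q.t) := mul_nonneg (by linarith) (by nlinarith)
  have h2 : 0 ≤ ‖p.z - q.z‖ ^ 2 * r := by positivity
  have h3 : (r - q.t) * (1 - r * q.t) = 0 := by nlinarith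
  have h4 : ‖p.z - q.z‖ ^ 2 = 0 := by
    have : ‖p.z - q.z‖ ^ 2 * r = 0 := by nlinarith
    exact (mul_eq_zero.1 this).resolve_right hr.ne'
  have h5 : q.t = r := by
    rcases mul_eq_zero.1 h3 with h | h
    · linarith
    · nlinarith
  have h6 : q.z = 0 := by
    rw [h5] at hq
    exact norm_eq_zero.1 (pow_eq_zero_iff two_ne_zero |>.1 (by linarith))
  have h7 : p.z = 0 := by
    have := norm_eq_zero.1 (pow_eq_zero_iff two_ne_zero |>.1 h4)
    rw [h6, sub_zero] at this
    exact this
  exact ⟨UpperHalfSpace.ext h7 hp, UpperHalfSpace.ext h6 h5⟩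

/-- The conjugate of `k` comes from `numer`; the denominator is even in `s` and contributes nothing
to first order. -/
lemma hasDerivAt_lower_smul (k : ℂ) {r : ℝ} (hr : 0 < r) :
    HasDerivAt (fun s : ℝ ↦ (lower (k * s) • mk 0 r hr).coords) (star k * (r : ℂ) ^ 2, (0 : ℝ)) 0 := by
  have hK : HasDerivAt (fun s : ℝ ↦ 1 + Complex.normSq k * r ^ 2 * s ^ 2) 0 0 := by
    simpa using ((hasDerivAt_pow 2 (0 : ℝ)).const_mul (Complex.normSq k * r ^ 2)).const_add 1
  have hK' := hK.inv (by norm_num)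
  have hz := ((Complex.ofRealCLM.hasDerivAt (x := 0)).mul_const (star k * (r : ℂ) ^ 2)).mul
    hK'.ofReal_comp
  have ht := hK'.const_mul r
  refine (hz.prodMk ht).congr_deriv (by simp) |>.congr_of_eventuallyEq (Eventually.of_forall ?_)
  intro s
  have hd : denom (lower (k * s)) (mk 0 r hr) = 1 + Complex.normSq k * r ^ 2 * s ^ 2 := by
    simp [denom, lower, Complex.normSq_ofReal]
    ring
  refine Prod.ext ?_ ?_
  · change (lower (k * s) • mk 0 r hr).z = _
    rw [smul_z, hd]
    simp [numer, lower]
    ring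
  · change (lower (k * s) • mk 0 r hr).t = _
    rw [smul_t, hd]
    simp [div_eq_mul_inv]

lemma hasDerivAt_scaling_smul_upper_smul {ρ : ℝ} (hρ : 0 < ρ) :
    HasDerivAt (fun s : ℝ ↦ (scaling ρ hρ • upper s • mk 0 1 one_pos).coords)
      ((ρ : ℂ) ^ 2, (0 : ℝ)) 0 := by
  have hz := (Complex.ofRealCLM.hasDerivAt (x := 0)).const_mul ((ρ : ℂ) ^ 2)
  refine (hz.prodMk (hasDerivAt_const 0 (ρ ^ 2))).congr_deriv (by simp)
    |>.congr_of_eventuallyEq (Eventually.of_forall fun s ↦ ?_)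
  simp only [upper_smul, scaling_smul]
  simp [coords, UpperHalfSpace.mk, z, t]

/-- The minimum is attained only at `(0, 1)` and `(0, 1 / |c|)`. Transport between them is the
scaling, which keeps the meridional direction real and positive, so the condition on `θ` is that `c
e^{-iθ}` be real and positive. Without `1 ≤ |c|` the horospheres would cross and `hdist` could not
give `log |c|`. -/
lemma isComplexDistanceBetween_iff {c : ℂ} (hc : 1 ≤ ‖c‖) (d θ : ℝ) :
    IsComplexDistanceBetween {p | p.t = 1} {p | ‖p.z‖ ^ 2 + p.t ^ 2 = p.t / ‖c‖} upper
      (fun u ↦ lower (c * u)) d θ ↔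
      d = Real.log ‖c‖ ∧ c * Complex.exp (-(θ * Complex.I)) = ‖c‖ := by
  have hc0 : 0 < ‖c‖ := by linarith
  set r : ℝ := ‖c‖⁻¹ with hr_def
  have hr : 0 < r := inv_pos.2 hc0
  have hr1 : r ≤ 1 := inv_le_one_of_one_le₀ hc
  have hrc : r⁻¹ = ‖c‖ := inv_inv _
  have hρ : 0 < √r := Real.sqrt_pos.2 hr
  have hρr : √r ^ 2 = r := Real.sq_sqrt hr.le
  have hp₀ : mk 0 1 one_pos ∈ {p : UpperHalfSpace | p.t = 1} := rfl
  have hq₀ : mk 0 r hr ∈ {p : UpperHalfSpace | ‖p.z‖ ^ 2 + p.t ^ 2 = p.t / ‖c‖} := by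
    simp [div_eq_mul_inv, ← hr_def, sq]
  have hv₁ := hasDerivAt_scaling_smul_upper_smul hρ
  have hv₂ := hasDerivAt_lower_smul (c * Complex.exp (-(θ * Complex.I))) hr
  have hfun : (fun s : ℝ ↦ (lower (c * Complex.exp (-(θ * Complex.I)) * s) • mk 0 r hr).coords) =
      fun s : ℝ ↦ (lower (c * (s * Complex.exp (-(θ * Complex.I)))) • mk 0 r hr).coords := by
    funext s
    rw [mul_right_comm, mul_assoc]
  rw [hfun] at hv₂
  have hangle : ((√r : ℂ) ^ 2 = star (c * Complex.exp (-(θ * Complex.I))) * (r : ℂ) ^ 2) ↔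
      c * Complex.exp (-(θ * Complex.I)) = ‖c‖ := by
    have hrc' : (r : ℂ) ≠ 0 := by exact_mod_cast hr.ne'
    rw [show (√r : ℂ) ^ 2 = (r : ℂ) by exact_mod_cast hρr, sq, ← mul_assoc,
      eq_comm, mul_eq_right₀ hrc', ← eq_mul_inv_iff_mul_eq₀ hrc', one_mul, ← Complex.ofReal_inv,
      hrc]
    constructor
    · intro h
      have := congrArg star h
      rw [star_star] at this
      rw [this]
      exact Complex.conj_ofReal _
    · intro h
      rw [h]
      exact Complex.conj_ofReal _
  constructor
  · rintro ⟨p, hp, q, hq, hmin, hd, T, v, hT, hv, hv'⟩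
    have h := hmin _ hp₀ _ hq₀
    rw [hdist_le_hdist_iff, euclSq_div_vertical] at h
    obtain ⟨rfl, rfl⟩ := eq_of_euclSq_div_le hr hr1 hp (by rwa [hr_def, ← div_eq_mul_inv]) h
    obtain rfl := hT.eq_scaling hρ hρr
    refine ⟨by rw [hd, hdist_vertical hr hr1, hrc], hangle.1 ?_⟩
    exact congrArg Prod.fst ((hv₁.unique hv).trans (hv'.unique hv₂))
  · rintro ⟨hd, hθ⟩
    refine ⟨_, hp₀, _, hq₀, fun p' hp' q' hq' ↦ ?_, ?_, scaling (√r) hρ, _,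
      isTransvection_scaling hρ hr hρr, hv₁, ?_⟩
    · rw [hdist_le_hdist_iff, euclSq_div_vertical]
      exact le_euclSq_div hr hr1 hp' (by rw [hr_def, ← div_eq_mul_inv]; exact hq')
    · rw [hdist_vertical hr hr1, hrc, hd]
    · rw [hangle.2 hθ]
      exact hv₂

/-- The angle is `arg c` modulo `2π`, an ambiguity that the exponential removes. -/
lemma exists_eq_exp_iff_eq_inv {c : ℂ} (hc : 1 ≤ ‖c‖) (w : ℂ) :
    (∃ d θ : ℝ, (d = Real.log ‖c‖ ∧ c * Complex.exp (-(θ * Complex.I)) = ‖c‖) ∧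
      w = Complex.exp (-(d + θ * Complex.I))) ↔ w = c⁻¹ := by
  have hc0 : 0 < ‖c‖ := by linarith
  have hcc : c ≠ 0 := norm_pos_iff.1 hc0
  have hnc : (‖c‖ : ℂ) ≠ 0 := by exact_mod_cast hc0.ne'
  have key : ∀ θ : ℝ, c * Complex.exp (-(θ * Complex.I)) = ‖c‖ →
      Complex.exp (-((Real.log ‖c‖ : ℝ) + θ * Complex.I)) = c⁻¹ := by
    intro θ h
    have h1 : Complex.exp (Real.log ‖c‖ : ℝ) = ‖c‖ := by
      rw [← Complex.ofReal_exp, Real.exp_log hc0]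
    rw [neg_add, Complex.exp_add, Complex.exp_neg, h1, inv_eq_one_div c, eq_div_iff hcc, mul_assoc,
      mul_comm _ c, h, inv_mul_cancel₀ hnc]
  constructor
  · rintro ⟨d, θ, ⟨rfl, h⟩, rfl⟩
    exact key θ h
  · rintro rfl
    have h : c * Complex.exp (-(c.arg * Complex.I)) = ‖c‖ := by
      nth_rewrite 1 [← Complex.norm_mul_exp_arg_mul_I c]
      rw [mul_assoc, ← Complex.exp_add, add_neg_cancel, Complex.exp_zero, mul_one]
    exact ⟨_, c.arg, ⟨rfl, h⟩, (key _ h).symm⟩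

/-! ### Geodesic lines -/

lemma geodesicLine_smul_subset (g : SL(2, ℂ)) (P Q : OnePoint ℂ) :
    g • geodesicLine P Q ⊆ geodesicLine (moebius g P) (moebius g Q) := by
  rintro _ ⟨_, ⟨h, h0, h1, t, ht, rfl⟩, rfl⟩
  exact ⟨g * h, by rw [moebius_mul, h0], by rw [moebius_mul, h1], t, ht, (mul_smul _ _ _).symm⟩

lemma geodesicLine_smul (g : SL(2, ℂ)) (P Q : OnePoint ℂ) :
    geodesicLine (moebius g P) (moebius g Q) = g • geodesicLine P Q := by
  refine (geodesicLine_smul_subset g P Q).antisymm' ?_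
  have := geodesicLine_smul_subset g⁻¹ (moebius g P) (moebius g Q)
  rw [moebius_inv_eq rfl, moebius_inv_eq rfl, Set.smul_set_subset_iff_subset_inv_smul_set,
    inv_inv] at this
  exact this

lemma geodesicLine_zero_infty :
    geodesicLine ((0 : ℂ) : OnePoint ℂ) OnePoint.infty = {p | p.z = 0} := by
  ext p
  constructor
  · rintro ⟨h, h0, h1, t, ht, rfl⟩
    rw [moebius_infty] at h1
    rw [moebius_coe] at h0
    have hc : h 1 0 = 0 := by
      by_contra hc
      simp [hc] at h1
    have hd := det_eq h
    have hd' : h 1 1 ≠ 0 := by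
      intro h0
      simp [hc, h0] at hd
    have hb : h 0 1 = 0 := by
      simpa only [hc, zero_mul, zero_add, hd', if_false, OnePoint.coe_eq_coe, mul_zero,
        div_eq_zero_iff, or_false] using h0
    simp [smul_z, numer, hc, hb]
  · intro hp
    exact ⟨1, moebius_one _, moebius_one _, p.t, p.t_pos, by
      rw [one_smul]; exact UpperHalfSpace.ext hp rfl⟩

lemma geodesicLine_infty_zero :
    geodesicLine OnePoint.infty ((0 : ℂ) : OnePoint ℂ) = {p | p.z = 0} := by
  -- The half-turn `z ↦ -1 / z` swaps the ends `0` and `∞` of the vertical axis and preserves it.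
  set J : SL(2, ℂ) := ofEntries 0 (-1) 1 0 (by ring) with hJ
  have h0 : moebius J ((0 : ℂ) : OnePoint ℂ) = OnePoint.infty := by
    rw [moebius_coe]; simp [hJ]
  have h1 : moebius J OnePoint.infty = ((0 : ℂ) : OnePoint ℂ) := by
    rw [moebius_infty]; simp [hJ]
  have h := geodesicLine_smul J ((0 : ℂ) : OnePoint ℂ) OnePoint.infty
  rw [h0, h1] at h
  rw [h, geodesicLine_zero_infty]
  ext p
  have hd : (denom J⁻¹ p : ℂ) ≠ 0 := by exact_mod_cast (denom_pos J⁻¹ p).ne'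
  obtain ⟨i1, i2, i3, i4⟩ := inv_entries J
  rw [Set.mem_smul_set_iff_inv_smul_mem, Set.mem_ofPred_eq, Set.mem_ofPred_eq, smul_z,
    div_eq_zero_iff, or_iff_left hd, numer, i1, i2, i3, i4]
  simp [hJ]

lemma upper_smul_setOf_z (a : ℂ) :
    upper a • {p : UpperHalfSpace | p.z = 0} = {p | p.z = a} := by
  ext p
  rw [Set.mem_smul_set_iff_inv_smul_mem, upper_inv, upper_smul]
  simp [← sub_eq_add_neg, sub_eq_zero]

lemma geodesicLine_coe_infty (a : ℂ) :
    geodesicLine (a : OnePoint ℂ) OnePoint.infty = {p | p.z = a} := by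
  rw [← upper_smul_setOf_z, ← geodesicLine_zero_infty, ← geodesicLine_smul, moebius_upper,
    moebius_upper_infty, zero_add]

lemma geodesicLine_infty_coe (a : ℂ) :
    geodesicLine OnePoint.infty (a : OnePoint ℂ) = {p | p.z = a} := by
  rw [← upper_smul_setOf_z, ← geodesicLine_infty_zero, ← geodesicLine_smul, moebius_upper,
    moebius_upper_infty, zero_add]

/-! ### The parameters in normal form, and the traces that contain them. -/

namespace CuspSections

variable {Γ : Subgroup PSL(2, ℂ)} (S : CuspSections Γ)

lemma exists_moebius_coe_eq {P Q : CuspPoint Γ} (hPQ : P ≠ Q) {g : SL(2, ℂ)}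
    (hg : moebius g OnePoint.infty = P.1) : ∃ x : ℂ, moebius g (x : OnePoint ℂ) = Q.1 := by
  have h : moebius g⁻¹ Q.1 ≠ OnePoint.infty := by
    intro h
    apply hPQ
    apply Subtype.ext
    rw [← hg, ← h, ← moebius_mul, mul_inv_cancel, moebius_one]
  obtain ⟨x, hx⟩ := OnePoint.ne_infty_iff_exists.1 h
  exact ⟨x, by rw [hx, ← moebius_mul, mul_inv_cancel, moebius_one]⟩

/-- Two cusps can be moved to `∞` and `0` so that the first meridian becomes the translation
by `1`. -/
lemma exists_normal_form_pair {P Q : CuspPoint Γ} (hPQ : P ≠ Q) : ∃ (g : SL(2, ℂ)) (c : ℂ),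
    c ≠ 0 ∧ S.mer P = g * upper 1 * g⁻¹ ∧ S.horo P = g • {p | p.t = 1} ∧
      S.mer Q = g * lower c * g⁻¹ ∧ S.horo Q = g • {p | ‖p.z‖ ^ 2 + p.t ^ 2 = p.t / ‖c‖} := by
  obtain ⟨k, hk, hmer, hH⟩ := S.exists_normal_form P
  obtain ⟨x, hx⟩ := exists_moebius_coe_eq hPQ hk
  have h0 : moebius (k * upper x) ((0 : ℂ) : OnePoint ℂ) = Q.1 := by
    rw [moebius_mul, moebius_upper, zero_add, hx]
  obtain ⟨c, hc, hmer', hH'⟩ := S.exists_normal_form_zero Q h0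
  refine ⟨k * upper x, c, hc, ?_, ?_, hmer', hH'⟩
  · have : upper x * upper 1 = upper 1 * upper x := by rw [← upper_add, ← upper_add, add_comm]
    rw [mul_assoc k, this, hmer]
    group
  · rw [hH, mul_smul]
    congr 1
    ext p
    rw [Set.mem_smul_set_iff_inv_smul_mem, upper_inv, upper_smul]
    rfl

lemma trace_mem_invariantTraceField {A : SL(2, ℂ)}
    (hA : (A : PSL(2, ℂ)) ∈ Subgroup.closure {δ | ∃ γ ∈ Γ, δ = γ ^ 2}) :
    A 0 0 + A 1 1 ∈ invariantTraceField Γ := by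
  rw [← Matrix.trace_fin_two]
  exact IntermediateField.subset_adjoin _ _ ⟨A, hA, rfl⟩

lemma mer_sq_mem (P : CuspPoint Γ) :
    ((S.mer P ^ 2 : SL(2, ℂ)) : PSL(2, ℂ)) ∈ Subgroup.closure {δ | ∃ γ ∈ Γ, δ = γ ^ 2} :=
  Subgroup.subset_closure ⟨_, S.mer_mem P, QuotientGroup.mk_pow _ _ _⟩

lemma trace_mem_of_conj_mem {g X : SL(2, ℂ)} (h : ((g * X * g⁻¹ : SL(2, ℂ)) : PSL(2, ℂ)) ∈
    Subgroup.closure {δ | ∃ γ ∈ Γ, δ = γ ^ 2}) : X 0 0 + X 1 1 ∈ invariantTraceField Γ := by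
  have h1 := trace_mem_invariantTraceField h
  rwa [← Matrix.trace_fin_two, Matrix.SpecialLinearGroup.coe_mul, Matrix.trace_mul_comm,
    ← Matrix.SpecialLinearGroup.coe_mul, ← mul_assoc, inv_mul_cancel, one_mul,
    Matrix.trace_fin_two] at h1

lemma mem_of_mul_mem {k : IntermediateField ℚ ℂ} {x y : ℂ} (hx : x ∈ k) (hx0 : x ≠ 0)
    (h : x * y ∈ k) : y ∈ k := by
  have := k.mul_mem (k.inv_mem hx) h
  rwa [inv_mul_cancel_left₀ hx0] at this

/-- The product of the squared meridians is conjugate to `upper 2 * lower (2 * c)`, of trace `2 + 4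
c`. -/
lemma lower_mem_invariantTraceField {P Q : CuspPoint Γ} {g : SL(2, ℂ)} {c : ℂ}
    (hP : S.mer P = g * upper 1 * g⁻¹) (hQ : S.mer Q = g * lower c * g⁻¹) :
    c ∈ invariantTraceField Γ := by
  have h := Subgroup.mul_mem _ (S.mer_sq_mem P) (S.mer_sq_mem Q)
  rw [← QuotientGroup.mk_mul, hP, hQ, conj_pow, conj_pow,
    show g * upper 1 ^ 2 * g⁻¹ * (g * lower c ^ 2 * g⁻¹) =
      g * (upper (2 * 1) * lower (2 * c)) * g⁻¹ by
      rw [← upper_pow_two, ← lower_pow_two]; group] at h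
  have h1 := trace_mem_of_conj_mem h
  simp only [mul_entry, upper, lower, ofEntries_zero_zero, ofEntries_zero_one,
    ofEntries_one_zero, ofEntries_one_one] at h1
  have h2 := sub_mem h1 (ofNat_mem (invariantTraceField Γ) 2)
  refine mem_of_mul_mem (ofNat_mem (invariantTraceField Γ) 4) (by norm_num) ?_
  convert h2 using 1
  ring

lemma isIntercuspParameter_iff (hΓ : DiscreteTopology Γ) {P Q : CuspPoint Γ} {g : SL(2, ℂ)} {c : ℂ}
    (hc : c ≠ 0) (hP : S.mer P = g * upper 1 * g⁻¹) (hHP : S.horo P = g • {p | p.t = 1})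
    (hQ : S.mer Q = g * lower c * g⁻¹)
    (hHQ : S.horo Q = g • {p | ‖p.z‖ ^ 2 + p.t ^ 2 = p.t / ‖c‖}) (w : ℂ) :
    S.IsIntercuspParameter P Q w ↔ w = c⁻¹ := by
  have hc1 : 1 ≤ ‖c‖ := one_le_norm_of_discrete hΓ g (lower c) (hP ▸ S.mer_mem P)
    (hQ ▸ S.mer_mem Q) hc
  rw [← exists_eq_exp_iff_eq_inv hc1]
  refine exists_congr fun d ↦ exists_congr fun θ ↦ and_congr_left' ?_
  rw [← isComplexDistanceBetween_iff hc1 d θ,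
    ← isComplexDistanceBetween_smul_iff upper_zero
      (by rw [mul_zero]; apply ext_entries <;> simp [lower]) g, ← hHP, ← hHQ]
  have h1 : (fun u ↦ g * upper u * g⁻¹) = S.translation P := funext fun u ↦ by
    rw [S.translation_eq_upper hP, one_mul]
  have h2 : (fun u ↦ g * lower (c * u) * g⁻¹) = S.translation Q := funext fun u ↦ by
    rw [S.translation_eq_lower hQ]
  rw [h1, h2]
  rfl

/-- With `Q` at `∞`, the two geodesics are the verticals over `a` and `b`, each meeting the plane of
height `1` in one point. -/
lemma isTranslationParameter_iff {P Q R : CuspPoint Γ} {g : SL(2, ℂ)} {a b : ℂ}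
    (hgP : moebius g (a : OnePoint ℂ) = P.1) (hgQ : moebius g OnePoint.infty = Q.1)
    (hgR : moebius g (b : OnePoint ℂ) = R.1) (hQ : S.mer Q = g * upper 1 * g⁻¹)
    (hHQ : S.horo Q = g • {p | p.t = 1}) (u : ℂ) :
    S.IsTranslationParameter P Q R u ↔ u = b - a := by
  have hpoint : ∀ x : ℂ, {p : UpperHalfSpace | p.t = 1} ∩ {p | p.z = x} =
      {UpperHalfSpace.mk x 1 one_pos} := by
    intro x
    ext p
    exact ⟨fun h ↦ UpperHalfSpace.ext h.2 h.1, by rintro rfl; exact ⟨rfl, rfl⟩⟩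
  rw [IsTranslationParameter, ← hgP, ← hgQ, ← hgR, geodesicLine_smul, geodesicLine_smul,
    geodesicLine_coe_infty, geodesicLine_infty_coe, hHQ, ← Set.smul_set_inter,
    ← Set.smul_set_inter, hpoint, hpoint, Set.smul_set_singleton, Set.smul_set_singleton,
    S.translation_eq_upper hQ]
  simp only [Set.mem_singleton_iff, exists_eq_left, one_mul, mul_smul, inv_smul_smul, upper_smul,
    smul_left_cancel_iff]
  constructor
  · intro h
    have := congrArg UpperHalfSpace.z h
    simp only [z_mk] at this
    linear_combination this
  · rintro rfl
    ext <;> simp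

lemma sub_mem_invariantTraceField {P Q R : CuspPoint Γ} {g : SL(2, ℂ)} {a b : ℂ}
    (hgP : moebius g (a : OnePoint ℂ) = P.1) (hgR : moebius g (b : OnePoint ℂ) = R.1)
    (hQ : S.mer Q = g * upper 1 * g⁻¹) : b - a ∈ invariantTraceField Γ := by
  -- Translations commute, so `g * upper x` still normalizes `Q` while bringing the point `x` to
  -- `0`. With `x = a` and `x = b`, the pairs `(Q, P)` and `(Q, R)` are each in normal form.
  have hQx : ∀ x : ℂ, S.mer Q = g * upper x * upper 1 * (g * upper x)⁻¹ := by
    intro x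
    rw [mul_assoc g, ← upper_add, add_comm, upper_add, hQ]
    group
  have hzero : ∀ x : ℂ, moebius (g * upper x) ((0 : ℂ) : OnePoint ℂ) = moebius g x := by
    intro x
    rw [moebius_mul, moebius_upper, zero_add]
  obtain ⟨c, hc, hP, -⟩ := S.exists_normal_form_zero P ((hzero a).trans hgP)
  obtain ⟨e, he, hR, -⟩ := S.exists_normal_form_zero R ((hzero b).trans hgR)
  have hck := S.lower_mem_invariantTraceField (hQx a) hP
  have hek := S.lower_mem_invariantTraceField (hQx b) hR
  have hPR := Subgroup.mul_mem _ (S.mer_sq_mem P) (S.mer_sq_mem R)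
  have hQPR := Subgroup.mul_mem _ (S.mer_sq_mem Q) hPR
  have hPR' : S.mer P ^ 2 * S.mer R ^ 2 = g * (upper a * lower (2 * c) * upper (-a) *
      (upper b * lower (2 * e) * upper (-b))) * g⁻¹ := by
    rw [hP, hR, conj_pow, conj_pow, lower_pow_two, lower_pow_two, ← upper_inv, ← upper_inv]
    group
  have hQPR' : S.mer Q ^ 2 * (S.mer P ^ 2 * S.mer R ^ 2) = g * (upper (2 * 1) *
      (upper a * lower (2 * c) * upper (-a) * (upper b * lower (2 * e) * upper (-b)))) * g⁻¹ := by
    rw [hPR', hQ, conj_pow, upper_pow_two]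
    group
  rw [← QuotientGroup.mk_mul] at hPR
  rw [← QuotientGroup.mk_mul, ← QuotientGroup.mk_mul, hQPR'] at hQPR
  rw [hPR'] at hPR
  have h1 := trace_mem_of_conj_mem hPR
  have h2 := trace_mem_of_conj_mem hQPR
  simp only [mul_entry, upper, lower, ofEntries_zero_zero, ofEntries_zero_one,
    ofEntries_one_zero, ofEntries_one_one] at h1 h2
  have h4 := ofNat_mem (invariantTraceField Γ) 4
  have h8 := ofNat_mem (invariantTraceField Γ) 8
  -- Multiplying by `upper 2` on the left adds twice the lower left entry to the trace. That entry
  -- is `2 c + 2 e + 4 c e (b - a)`, so `8 c e (b - a)` is left here.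
  have h3 := sub_mem (sub_mem h2 h1) (mul_mem h4 (add_mem hck hek))
  refine mem_of_mul_mem (mul_mem h8 (mul_mem hck hek))
    (mul_ne_zero (by norm_num) (mul_ne_zero hc he)) ?_
  convert h3 using 1
  ring

end CuspSections

end HypThree

end

theorem theorem3 (Γ : Subgroup (Matrix.ProjectiveSpecialLinearGroup (Fin 2) ℂ))
    (hΓ : HypThree.IsFiniteVolumeManifoldGroup Γ) (S : HypThree.CuspSections Γ) :
    (∀ P Q : HypThree.CuspPoint Γ, P ≠ Q →
      (∃! w : ℂ, S.IsIntercuspParameter P Q w) ∧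
        ∀ w : ℂ, S.IsIntercuspParameter P Q w → w ∈ HypThree.invariantTraceField Γ) ∧
    (∀ P Q R : HypThree.CuspPoint Γ, P ≠ Q → Q ≠ R →
      (∃! u : ℂ, S.IsTranslationParameter P Q R u) ∧
        ∀ u : ℂ, S.IsTranslationParameter P Q R u → u ∈ HypThree.invariantTraceField Γ) := by
  refine ⟨fun P Q hPQ ↦ ?_, fun P Q R hPQ hQR ↦ ?_⟩
  · obtain ⟨g, c, hc, hP, hHP, hQ, hHQ⟩ := S.exists_normal_form_pair hPQ
    simp only [S.isIntercuspParameter_iff hΓ.discrete hc hP hHP hQ hHQ]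
    refine ⟨existsUnique_eq, ?_⟩
    rintro _ rfl
    exact inv_mem (S.lower_mem_invariantTraceField hP hQ)
  · obtain ⟨g, hgQ, hQ, hHQ⟩ := S.exists_normal_form Q
    obtain ⟨a, ha⟩ := HypThree.CuspSections.exists_moebius_coe_eq hPQ.symm hgQ
    obtain ⟨b, hb⟩ := HypThree.CuspSections.exists_moebius_coe_eq hQR hgQ
    simp only [S.isTranslationParameter_iff ha hgQ hb hQ hHQ]
    refine ⟨existsUnique_eq, ?_⟩
    rintro _ rfl
    exact S.sub_mem_invariantTraceField ha hb hQ
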